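/- Let $N\ge 5$ be odd. A quantum realization of the $N$-cycle scenario is a density operator $\rho$ on a finite-dimensional Hilbert space with projectors $\Pi_i$, $i\in\mathbb Z/N$, such that $\Pi_i$ and $\Pi_{i+1}$ commute for every $i$. The measurement of $\Pi_i$ has outcome $1$ for $\Pi_i$ and outcome $0$ for $\mathbb 1-\Pi_i$. Put $\beta=\sum_{i} p(1,0\,|\,i,i+1)$, where $p(1,0\,|\,i,i+1)$ is the probability of outcomes $1$ and $0$ when $\Pi_i$ and then $\Pi_{i+1}$ are measured on $\rho$, and let $\beta_{\mathrm{QT}}$ be the supremum of $\beta$ over all quantum realizations. Let $\|X\|=\operatorname{tr}\sqrt{X^\dagger X}$. There is a constant $C$, depending only on $N$, such that the following holds for all $m\in\mathbb N$ and $\epsilon\ge 0$. Suppose that in each of $m$ generation rounds $j=1,\dots,m$ Alice implements a strategy consisting of a (possibly mixed) state $\tilde\rho_{A_j}$ and rank-one projectors $\tilde\Pi^{(j)}_i=|\tilde v^{(j)}_i\rangle\langle\tilde v^{(j)}_i|$, $i\in\mathbb Z/N$, with cyclically adjacent ones commuting, and that it achieves $\beta\ge\beta_{\mathrm{QT}}-\epsilon$.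 Let Eve hold, for each round, a system $E_j$ (of any finite dimension) that purifies $\tilde\rho_{A_j}$ to $|\psi_j\rangle_{A_jE_j}$. The devices are memoryless: the joint state is $\bigotimes_j|\psi_j\rangle$, and in each round Alice measures $\tilde\Pi^{(j)}_1$, obtains $k_j\in\{0,1\}$, and, independently, records it with probability $\omega_{k_j}$, where $\omega_0=\cos(\pi/N)$ and $\omega_1=1$. Let $\rho_{KE}$ be the classical-quantum state of the bit string $\boldsymbol k=(k_1,\dots,k_m)$ and of Eve's systems, conditioned on all $m$ outcomes being recorded. Then there are unit vectors $|\xi_j\rangle\in\mathcal H_{E_j}$ such that, with $\rho_E=\bigotimes_{j=1}^m|\xi_j\rangle\langle\xi_j|$, $$\bigl\|\rho_{KE}-2^{-m}\,\mathbb 1_K\otimes\rho_E\bigr\|\le C\,m\sqrt\epsilon ,$$ where $\mathbb 1_K$ is the identity on $(\mathbb C^2)^{\otimes m}$. Here $|\xi_j\rangle$ is Eve's state in the $j$th post-selected round, in the sense that her reduced state in that round (conditioned on its outcome being recorded) is within $C\sqrt\epsilon$ of $|\xi_j\rangle\langle\xi_j|$ in trace norm. The bound $C\,m\sqrt\epsilon$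 also holds when $\rho_E$ is replaced by Eve's exact reduced state $\operatorname{tr}_K\rho_{KE}$. -/

import Mathlib

open Matrix
open scoped Kronecker

namespace NCRandomness

/-! ### Matrices, partial traces, tensor products -/

open scoped MatrixOrder ComplexOrder in
/-- The trace norm `‖X‖ = tr √(X† X)`. -/
noncomputable def traceNorm {n : Type*} [Fintype n] [DecidableEq n] (X : Matrix n n ℂ) : ℝ :=
  (CFC.sqrt (Xᴴ * X)).trace.re

/-- The partial trace over the first tensor factor. -/
def traceFst {α η : Type*} [Fintype α] (X : Matrix (α × η) (α × η) ℂ) : Matrix η η ℂ :=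
  Matrix.of fun e e' => ∑ a, X (a, e) (a, e')

/-- The partial trace over the second tensor factor. -/
def traceSnd {α η : Type*} [Fintype η] (X : Matrix (α × η) (α × η) ℂ) : Matrix α α ℂ :=
  Matrix.of fun a a' => ∑ e, X (a, e) (a', e)

/-- The operator `|v⟩⟨v|`. -/
def ketbra {α : Type*} (v : α → ℂ) : Matrix α α ℂ := vecMulVec v (star v)

/-- `v` is a unit vector of the finite-dimensional Hilbert space `ℂ^α`. -/
def IsUnitVec {α : Type*} [Fintype α] (v : α → ℂ) : Prop := ∑ a, ‖v a‖ ^ 2 = 1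

/-- The tensor product `⨂ⱼ Xⱼ`, acting on `⨂ⱼ ℂ^(A j)`, whose computational basis is `∏ⱼ A j`. -/
def tensorPi {m : ℕ} {A : Fin m → Type*} (X : ∀ j, Matrix (A j) (A j) ℂ) :
    Matrix (∀ j, A j) (∀ j, A j) ℂ :=
  Matrix.of fun a b => ∏ j, X j (a j) (b j)

/-! ### Two-outcome projective measurements and the odd cycle inequality -/

/-- The effect of outcome `a` in the two-outcome measurement of the projector `P`:
outcome `1` corresponds to `P` and outcome `0` to `1 - P`. -/
def effect {α : Type*} [DecidableEq α] (P : Matrix α α ℂ) (a : Fin 2) : Matrix α α ℂ :=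
  if a = 1 then P else 1 - P

/-- The probability of obtaining first `a` for `P` and then `b` for `Q`, when the ideal
measurements of `P` and `Q` are performed one after the other on the state `ρ`. -/
def seqProb {α : Type*} [Fintype α] [DecidableEq α] (ρ P Q : Matrix α α ℂ) (a b : Fin 2) : ℝ :=
  (effect Q b * (effect P a * ρ * effect P a) * effect Q b).trace.re

/-- The value `β = ∑ᵢ p(1,0|i,i+1)`, with indices modulo `N`. -/
def ncValue {N : ℕ} [NeZero N] {α : Type*} [Fintype α] [DecidableEq α]
    (ρ : Matrix α α ℂ) (P : ZMod N → Matrix α α ℂ) : ℝ :=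
  ∑ i, seqProb ρ (P i) (P (i + 1)) 1 0

open scoped ComplexOrder in
/-- A quantum realization of the `N`-cycle scenario: a state, and `N` projective two-outcome
measurements such that neighbouring ones are compatible. -/
structure IsRealization {N : ℕ} {α : Type*} [Fintype α]
    (ρ : Matrix α α ℂ) (P : ZMod N → Matrix α α ℂ) : Prop where
  state_psd : ρ.PosSemidef
  state_trace : ρ.trace = 1
  hermitian : ∀ i, (P i).IsHermitian
  idempotent : ∀ i, P i * P i = P i
  compatible : ∀ i, Commute (P i) (P (i + 1))

/-- The maximal quantum value `β_QT` of the `N`-cycle expression. -/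
noncomputable def betaQT (N : ℕ) [NeZero N] : ℝ :=
  sSup {b : ℝ | ∃ (d : ℕ) (ρ : Matrix (Fin d) (Fin d) ℂ) (P : ZMod N → Matrix (Fin d) (Fin d) ℂ),
    IsRealization ρ P ∧ b = ncValue ρ P}

/-! ### One round, with an adversary -/

/-- What the devices implement in one round: a pure joint state `ψ` of Alice (system `α`) and
Eve (system `η`), that is, Eve purifies Alice's possibly mixed state, and rank-one projective
measurements `|vᵢ⟩⟨vᵢ|` of Alice, neighbouring ones being compatible. -/
structure Strategy (N : ℕ) (α η : Type*) [Fintype α] [Fintype η] where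
  psi : α × η → ℂ
  psi_unit : IsUnitVec psi
  v : ZMod N → α → ℂ
  v_unit : ∀ i, IsUnitVec (v i)
  compatible : ∀ i, Commute (ketbra (v i)) (ketbra (v (i + 1)))

namespace Strategy

variable {N : ℕ} {α η : Type*} [Fintype α] [Fintype η]

/-- Alice's measurement projectors. -/
def proj (S : Strategy N α η) (i : ZMod N) : Matrix α α ℂ := ketbra (S.v i)

/-- Alice's reduced state. -/
def aliceState (S : Strategy N α η) : Matrix α α ℂ := traceSnd (ketbra S.psi)

/-- The value of the `N`-cycle expression that Alice observes. -/
def beta [NeZero N] [DecidableEq α] (S : Strategy N α η) : ℝ := ncValue S.aliceState S.proj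

end Strategy

/-! ### Post-selected classical-quantum states -/

section PostSelection

variable {κ α η : Type*} [Fintype κ] [DecidableEq κ] [Fintype α] [Fintype η] [DecidableEq η]

/-- Alice measures `M` on her part of `ρ` and keeps the outcome `k` with probability `w k`. This is
the subnormalized state of her classical register and of Eve on the event that it is kept:
`∑ₖ w(k) |k⟩⟨k| ⊗ tr_A[(Mₖ ⊗ 1) ρ]`. -/
def keptState (ρ : Matrix (α × η) (α × η) ℂ) (M : κ → Matrix α α ℂ) (w : κ → ℝ) :
    Matrix (κ × η) (κ × η) ℂ :=
  ∑ k, (w k : ℂ) • (Matrix.single k k (1 : ℂ) ⊗ₖ traceFst ((M k ⊗ₖ (1 : Matrix η η ℂ)) * ρ))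

/-- The state of Alice's classical register and of Eve, conditioned on the outcome being kept. -/
noncomputable def postSelected (ρ : Matrix (α × η) (α × η) ℂ) (M : κ → Matrix α α ℂ)
    (w : κ → ℝ) : Matrix (κ × η) (κ × η) ℂ :=
  (keptState ρ M w).trace⁻¹ • keptState ρ M w

end PostSelection

/-- The probability with which an outcome of `Π₁` is recorded in a generation round:
`ω₀ = cos (π / N)` and `ω₁ = 1`. -/
noncomputable def omega (N : ℕ) (a : Fin 2) : ℝ := if a = 1 then 1 else Real.cos (Real.pi / N)

/-- The state of the recorded bit and of Eve after one post-selected generation round. -/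
noncomputable def roundState {N : ℕ} {α η : Type*} [Fintype α] [DecidableEq α] [Fintype η]
    [DecidableEq η] (S : Strategy N α η) : Matrix (Fin 2 × η) (Fin 2 × η) ℂ :=
  postSelected (ketbra S.psi) (effect (S.proj 1)) (omega N)

section Protocol

variable {N m : ℕ} {A E : Fin m → Type*} [∀ j, Fintype (A j)] [∀ j, DecidableEq (A j)]
  [∀ j, Fintype (E j)] [∀ j, DecidableEq (E j)]

/-- The joint pure state of Alice and Eve over `m` rounds with memoryless preparation devices:
the product of the states of the rounds, with all of Alice's systems grouped first. -/
def jointPsi (S : ∀ j, Strategy N (A j) (E j)) : (∀ j, A j) × (∀ j, E j) → ℂ :=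
  fun x => ∏ j, (S j).psi (x.1 j, x.2 j)

/-- The state `ρ_KE` of the final bit string `k ∈ {0,1}^m` and of Eve: memoryless measurement
devices measure `Π₁` in each of the `m` rounds, each outcome `a` is recorded independently with
probability `ω_a`, and all `m` outcomes have been recorded. -/
noncomputable def finalState (S : ∀ j, Strategy N (A j) (E j)) :
    Matrix ((Fin m → Fin 2) × (∀ j, E j)) ((Fin m → Fin 2) × (∀ j, E j)) ℂ :=
  postSelected (ketbra (jointPsi S))
    (fun k : Fin m → Fin 2 => tensorPi fun j => effect ((S j).proj 1) (k j))
    (fun k => ∏ j, omega N (k j))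

/-- `2^{-m} 1_K ⊗ σ`: a uniform `m`-bit string that is independent of Eve's state `σ`. -/
noncomputable def idealState (σ : Matrix (∀ j, E j) (∀ j, E j) ℂ) :
    Matrix ((Fin m → Fin 2) × (∀ j, E j)) ((Fin m → Fin 2) × (∀ j, E j)) ℂ :=
  ((2 : ℂ) ^ m)⁻¹ • ((1 : Matrix (Fin m → Fin 2) (Fin m → Fin 2) ℂ) ⊗ₖ σ)

end Protocol

end NCRandomness

/-!
Write `c = cos (π / N)` and `θ = N c / (1 + c)`, the Lovász number of the odd cycle.

*The optimal value.* For commuting projections the event "`Π i = 1`, then `Π (i + 1) = 0`" is the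
projection `Q i = Π i (1 - Π (i + 1))`, and cyclically adjacent `Q i` are orthogonal. The matrix
`T = 1 - J / θ + A / (2c)`, with `J` all ones and `A` the adjacency matrix of the cycle, is positive
semidefinite (it is diagonal in the Fourier basis, `sum_norm_sq_cycleKernel_le`), and
`θ - ∑ Q i = (θ - ∑ Q i)² / θ + ∑ T i j Q i Q j` (`CyclicProjections.deficit_eq`). An umbrella of
vectors in dimension three attains `θ`, so `θ ≤ β_QT` (`lovaszTheta_le_betaQT`); the reverse
inequality is not needed.

*Self-testing.* A state with deficit at most `ε` satisfies
`Q (i - 1) ψ + Q (i + 1) ψ = 2 c (ψ - Q i ψ)` up to `O(√ε)`. This relation yields two facts, both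
valid in any dimension: a vector annihilated by one `Q i` has deficit bounded below
(`CyclicProjections.norm_sq_le_of_apply_eq_zero`), and the outcome probabilities of a nearly
optimal state are `c / (1 + c) + O(√ε)` (`CyclicProjections.abs_prob_sub_le`).

*One round.* Since `Π 1` has rank one, Eve's state after outcome `1` is a pure state `ξ`. The
component of the joint state orthogonal to `ξ` on Eve's side is annihilated by `Q 1`, hence has
squared norm `O(ε)`: the joint state is `O(√ε)`-close to a product vector, on which the
post-selected state is explicit. The recording probabilities `c` and `1` balance the outcome
probabilities `1 / (1 + c)` and `c / (1 + c)`, so the bit is nearly uniform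
(`Strategy.exists_hasTraceNormLE`).

*Many rounds.* The final state is the tensor product of the states of the rounds
(`finalState_eq`), and distances of product states add up (`hasTraceNormLE_tensorPi_sub`). Trace
norms are estimated throughout by exhibiting a decomposition `P - Q` into positive matrices
(`HasTraceNormLE`).
-/

namespace NCRandomness

open scoped ComplexOrder InnerProductSpace

/-! ### Bounding the trace norm by positive decompositions -/

/-- `X` is a difference `P - Q` of positive semidefinite matrices with `tr P + tr Q ≤ r`.
For Hermitian `X` this is equivalent to `‖X‖ ≤ r` in trace norm, but in this form it passes through
tensor products and positive maps without any spectral theory. -/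
def HasTraceNormLE {n : Type*} [Fintype n] (X : Matrix n n ℂ) (r : ℝ) : Prop :=
  ∃ P Q : Matrix n n ℂ, P.PosSemidef ∧ Q.PosSemidef ∧ X = P - Q ∧ P.trace.re + Q.trace.re ≤ r

open scoped MatrixOrder in
theorem traceNorm_eq_sum_abs_eigenvalues {n : Type*} [Fintype n] [DecidableEq n]
    {X : Matrix n n ℂ} (hX : X.IsHermitian) : traceNorm X = ∑ i, |hX.eigenvalues i| := by
  set U : Matrix n n ℂ := (hX.eigenvectorUnitary : Matrix n n ℂ) with hU
  have hUU : Uᴴ * U = 1 := Unitary.coe_star_mul_self hX.eigenvectorUnitary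
  set D : Matrix n n ℂ := diagonal fun i => ((hX.eigenvalues i : ℝ) : ℂ) with hD
  set B : Matrix n n ℂ := diagonal fun i => ((|hX.eigenvalues i| : ℝ) : ℂ) with hB
  have hXD : X = U * D * Uᴴ := by
    have := hX.spectral_theorem
    rw [Unitary.conjStarAlgAut_apply] at this
    exact this
  have hBpsd : B.PosSemidef := PosSemidef.diagonal fun i => by
    simp only [Pi.zero_apply]
    exact_mod_cast abs_nonneg _
  have hBB : B * B = D * D := by
    simp only [hB, hD, diagonal_mul_diagonal]
    congr 1
    funext i
    exact_mod_cast abs_mul_abs_self (hX.eigenvalues i)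
  have hsqrt : CFC.sqrt (Xᴴ * X) = U * B * Uᴴ := by
    refine CFC.sqrt_unique ?_ (hBpsd.mul_mul_conjTranspose_same U).nonneg
    rw [hX.eq]
    calc U * B * Uᴴ * (U * B * Uᴴ) = U * B * (Uᴴ * U) * B * Uᴴ := by noncomm_ring
      _ = U * (B * B) * Uᴴ := by rw [hUU]; noncomm_ring
      _ = U * D * (Uᴴ * U) * D * Uᴴ := by rw [hBB, hUU]; noncomm_ring
      _ = X * X := by rw [hXD]; noncomm_ring
  rw [traceNorm, hsqrt, trace_mul_comm, ← Matrix.mul_assoc, hUU, Matrix.one_mul, hB,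
    trace_diagonal, Complex.re_sum]
  simp

theorem HasTraceNormLE.traceNorm_le {n : Type*} [Fintype n] [DecidableEq n] {X : Matrix n n ℂ}
    {r : ℝ} (h : HasTraceNormLE X r) : traceNorm X ≤ r := by
  obtain ⟨P, Q, hP, hQ, rfl, hr⟩ := h
  have hX : (P - Q).IsHermitian := hP.1.sub hQ.1
  set U : Matrix n n ℂ := (hX.eigenvectorUnitary : Matrix n n ℂ) with hU
  have hUU : Uᴴ * U = 1 := Unitary.coe_star_mul_self hX.eigenvectorUnitary
  have hUU' : U * Uᴴ = 1 := Unitary.coe_mul_star_self hX.eigenvectorUnitary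
  have hD : Uᴴ * (P - Q) * U = diagonal fun i => ((hX.eigenvalues i : ℝ) : ℂ) := by
    have h1 : P - Q = U * (diagonal fun i => ((hX.eigenvalues i : ℝ) : ℂ)) * Uᴴ := by
      have := hX.spectral_theorem
      rw [Unitary.conjStarAlgAut_apply] at this
      exact this
    calc Uᴴ * (P - Q) * U
        = (Uᴴ * U) * (diagonal fun i => ((hX.eigenvalues i : ℝ) : ℂ)) * (Uᴴ * U) := by
          conv_lhs => rw [h1]
          noncomm_ring
      _ = _ := by rw [hUU]; simp
  have hW := hP.conjTranspose_mul_mul_same U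
  have hV := hQ.conjTranspose_mul_mul_same U
  have htr : ∀ Y : Matrix n n ℂ, (Uᴴ * Y * U).trace = Y.trace := fun Y => by
    rw [trace_mul_comm, ← Matrix.mul_assoc, hUU', Matrix.one_mul]
  rw [traceNorm_eq_sum_abs_eigenvalues hX]
  refine le_trans ?_ hr
  rw [← htr P, ← htr Q, trace, trace, Complex.re_sum, Complex.re_sum, ← Finset.sum_add_distrib]
  refine Finset.sum_le_sum fun i _ => ?_
  have h1 : hX.eigenvalues i = ((Uᴴ * P * U) i i).re - ((Uᴴ * Q * U) i i).re := by
    have := congrFun (congrFun hD i) i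
    rw [Matrix.mul_sub, Matrix.sub_mul, Matrix.sub_apply, diagonal_apply_eq] at this
    rw [← Complex.sub_re, this, Complex.ofReal_re]
  have h2 : 0 ≤ ((Uᴴ * P * U) i i).re := (Complex.nonneg_iff.mp hW.diag_nonneg).1
  have h3 : 0 ≤ ((Uᴴ * Q * U) i i).re := (Complex.nonneg_iff.mp hV.diag_nonneg).1
  simp only [diag_apply]
  rw [h1]
  exact abs_le.mpr ⟨by linarith, by linarith⟩

namespace HasTraceNormLE

variable {n m : Type*} [Fintype n] [Fintype m] {X Y : Matrix n n ℂ} {r s : ℝ}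

theorem mono (h : HasTraceNormLE X r) (hrs : r ≤ s) : HasTraceNormLE X s := by
  obtain ⟨P, Q, hP, hQ, hX, hr⟩ := h
  exact ⟨P, Q, hP, hQ, hX, hr.trans hrs⟩

theorem add (hX : HasTraceNormLE X r) (hY : HasTraceNormLE Y s) :
    HasTraceNormLE (X + Y) (r + s) := by
  obtain ⟨P, Q, hP, hQ, rfl, hr⟩ := hX
  obtain ⟨P', Q', hP', hQ', rfl, hs⟩ := hY
  refine ⟨P + P', Q + Q', hP.add hP', hQ.add hQ', by abel, ?_⟩
  simp only [trace_add, Complex.add_re]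
  linarith

theorem neg (hX : HasTraceNormLE X r) : HasTraceNormLE (-X) r := by
  obtain ⟨P, Q, hP, hQ, rfl, hr⟩ := hX
  exact ⟨Q, P, hQ, hP, by abel, by linarith⟩

theorem zero : HasTraceNormLE (0 : Matrix n n ℂ) 0 :=
  ⟨0, 0, PosSemidef.zero, PosSemidef.zero, by simp, by simp⟩

theorem sub_of_posSemidef (hX : X.PosSemidef) (hY : Y.PosSemidef) :
    HasTraceNormLE (X - Y) (X.trace.re + Y.trace.re) :=
  ⟨X, Y, hX, hY, rfl, le_rfl⟩

/-- A positive linear map that does not increase the trace of positive matrices by more than the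
factor `c` does not increase trace norms by more than `c`. -/
theorem map (hX : HasTraceNormLE X r) (f : Matrix n n ℂ →ₗ[ℂ] Matrix m m ℂ) {c : ℝ} (hc : 0 ≤ c)
    (hf : ∀ P : Matrix n n ℂ, P.PosSemidef → (f P).PosSemidef ∧ (f P).trace.re ≤ c * P.trace.re) :
    HasTraceNormLE (f X) (c * r) := by
  obtain ⟨P, Q, hP, hQ, rfl, hr⟩ := hX
  refine ⟨f P, f Q, (hf P hP).1, (hf Q hQ).1, map_sub f P Q, ?_⟩
  nlinarith [(hf P hP).2, (hf Q hQ).2]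

end HasTraceNormLE

theorem posSemidef_real_smul {n : Type*} [Fintype n] {X : Matrix n n ℂ} (hX : X.PosSemidef)
    {a : ℝ} (ha : 0 ≤ a) : ((a : ℂ) • X).PosSemidef :=
  hX.smul (Complex.zero_le_real.mpr ha)

theorem hasTraceNormLE_real_smul {n : Type*} [Fintype n] {X : Matrix n n ℂ} (hX : X.PosSemidef)
    (a : ℝ) : HasTraceNormLE ((a : ℂ) • X) (|a| * X.trace.re) := by
  rcases le_total 0 a with ha | ha
  · refine ⟨(a : ℂ) • X, 0, posSemidef_real_smul hX ha, PosSemidef.zero, by simp, ?_⟩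
    simp [abs_of_nonneg ha]
  · refine ⟨0, ((-a : ℝ) : ℂ) • X, PosSemidef.zero, posSemidef_real_smul hX (by linarith),
      by simp, ?_⟩
    simp [abs_of_nonpos ha]

/-! ### Pure states -/

theorem ketbra_posSemidef {ι : Type*} [Fintype ι] (u : ι → ℂ) : (ketbra u).PosSemidef :=
  posSemidef_vecMulVec_self_star u

theorem ketbra_apply {ι : Type*} (u : ι → ℂ) (i j : ι) : ketbra u i j = u i * star (u j) := rfl

theorem trace_ketbra {ι : Type*} [Fintype ι] (u : ι → ℂ) :
    (ketbra u).trace = ((∑ i, ‖u i‖ ^ 2 : ℝ) : ℂ) := by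
  simp [trace, ketbra_apply, Complex.mul_conj, Complex.normSq_eq_norm_sq]

theorem re_trace_ketbra {ι : Type*} [Fintype ι] (u : ι → ℂ) :
    (ketbra u).trace.re = ∑ i, ‖u i‖ ^ 2 := by
  rw [trace_ketbra, Complex.ofReal_re]

theorem IsUnitVec.trace_ketbra {ι : Type*} [Fintype ι] {u : ι → ℂ} (hu : IsUnitVec u) :
    (ketbra u).trace = 1 := by
  rw [NCRandomness.trace_ketbra, hu, Complex.ofReal_one]

theorem IsUnitVec.ketbra_mul_self {ι : Type*} [Fintype ι] {u : ι → ℂ} (hu : IsUnitVec u) :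
    ketbra u * ketbra u = ketbra u := by
  have h : star u ⬝ᵥ u = 1 := by
    rw [← hu.trace_ketbra, ketbra, trace_vecMulVec, dotProduct_comm]
  rw [ketbra, vecMulVec_mul_vecMulVec, h, one_smul]

theorem ketbra_isHermitian {ι : Type*} [Fintype ι] (u : ι → ℂ) : (ketbra u).IsHermitian :=
  (ketbra_posSemidef u).1

/-- Nearby vectors give nearby pure states, by polarizing
`uu* - ww* = ½ (ds* + sd*)` with `d = u - w` and `s = u + w`. -/
theorem hasTraceNormLE_ketbra_sub {ι : Type*} [Fintype ι] (u w : ι → ℂ) {δ : ℝ} (hδ : 0 ≤ δ)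
    (hs : ∑ i, ‖u i + w i‖ ^ 2 ≤ 4) (hd : ∑ i, ‖u i - w i‖ ^ 2 ≤ δ ^ 2) :
    HasTraceNormLE (ketbra u - ketbra w) (5 / 2 * δ) := by
  rcases hδ.eq_or_lt with rfl | hpos
  · have h0 : u = w := by
      funext i
      have h1 : ‖u i - w i‖ ^ 2 ≤ 0 :=
        (Finset.single_le_sum (f := fun i => ‖u i - w i‖ ^ 2) (fun i _ => by positivity)
          (Finset.mem_univ i)).trans (hd.trans_eq (by norm_num))
      have h2 : ‖u i - w i‖ = 0 := by
        have := sq_nonneg ‖u i - w i‖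
        exact pow_eq_zero_iff (two_ne_zero) |>.mp (le_antisymm h1 this)
      exact sub_eq_zero.mp (norm_eq_zero.mp h2)
    rw [h0, sub_self, mul_zero]
    exact HasTraceNormLE.zero
  set τ : ℝ := √δ with hτ
  have hτ0 : 0 < τ := Real.sqrt_pos.mpr hpos
  have hττ : τ ^ 2 = δ := Real.sq_sqrt hδ
  have hc : (τ : ℂ) ≠ 0 := by exact_mod_cast hτ0.ne'
  set a : ι → ℂ := fun i => (τ : ℂ) * (u i + w i) with ha
  set b : ι → ℂ := fun i => (τ : ℂ)⁻¹ * (u i - w i) with hb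
  refine ⟨((1 / 4 : ℝ) : ℂ) • ketbra (a + b), ((1 / 4 : ℝ) : ℂ) • ketbra (a - b),
    posSemidef_real_smul (ketbra_posSemidef _) (by norm_num),
    posSemidef_real_smul (ketbra_posSemidef _) (by norm_num), ?_, ?_⟩
  · ext i j
    simp only [Matrix.sub_apply, ketbra_apply, Matrix.smul_apply, smul_eq_mul, ha, hb,
      Pi.add_apply, Pi.sub_apply, star_add, star_sub, star_mul', star_inv₀]
    have : star (τ : ℂ) = τ := Complex.conj_ofReal τ
    rw [this]
    push_cast
    field_simp
    ring
  · have hpar : ∀ i, ‖(a + b) i‖ ^ 2 + ‖(a - b) i‖ ^ 2 =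
        2 * (δ * ‖u i + w i‖ ^ 2) + 2 * (δ⁻¹ * ‖u i - w i‖ ^ 2) := fun i => by
      have h1 := parallelogram_law_with_norm ℝ (a i) (b i)
      have h2 : ‖a i‖ ^ 2 = δ * ‖u i + w i‖ ^ 2 := by
        simp only [ha, norm_mul, Complex.norm_real, Real.norm_eq_abs, abs_of_pos hτ0, mul_pow, hττ]
      have h3 : ‖b i‖ ^ 2 = δ⁻¹ * ‖u i - w i‖ ^ 2 := by
        simp only [hb, norm_mul, norm_inv, Complex.norm_real, Real.norm_eq_abs, abs_of_pos hτ0,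
          mul_pow, inv_pow, hττ]
      simp only [Pi.add_apply, Pi.sub_apply]
      nlinarith
    simp only [trace_smul, smul_eq_mul, Complex.re_ofReal_mul, re_trace_ketbra]
    rw [← mul_add, ← Finset.sum_add_distrib, Finset.sum_congr rfl fun i _ => hpar i,
      Finset.sum_add_distrib, ← Finset.mul_sum, ← Finset.mul_sum, ← Finset.mul_sum,
      ← Finset.mul_sum]
    have h4 : δ⁻¹ * ∑ i, ‖u i - w i‖ ^ 2 ≤ δ := by
      rw [inv_mul_le_iff₀ hpos]
      linarith
    nlinarith

/-! ### Tensor products of states -/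

section Tensor

variable {m : ℕ} {B : Fin m → Type*}

theorem tensorPi_apply (X : ∀ j, Matrix (B j) (B j) ℂ) (a b : ∀ j, B j) :
    tensorPi X a b = ∏ j, X j (a j) (b j) := rfl

theorem tensorPi_update_sub (Z : ∀ j, Matrix (B j) (B j) ℂ) (j : Fin m)
    (X Y : Matrix (B j) (B j) ℂ) :
    tensorPi (Function.update Z j (X - Y)) =
      tensorPi (Function.update Z j X) - tensorPi (Function.update Z j Y) := by
  have key : ∀ W : Matrix (B j) (B j) ℂ, ∀ a b : ∀ i, B i,
      tensorPi (Function.update Z j W) a b =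
        W (a j) (b j) * ∏ i ∈ Finset.univ.erase j, Z i (a i) (b i) := fun W a b => by
    rw [tensorPi_apply, ← Finset.mul_prod_erase _ _ (Finset.mem_univ j), Function.update_self]
    congr 1
    exact Finset.prod_congr rfl fun i hi => by
      rw [Function.update_of_ne (Finset.ne_of_mem_erase hi)]
  ext a b
  rw [Matrix.sub_apply, key, key, key, Matrix.sub_apply, sub_mul]

variable [∀ j, Fintype (B j)]

theorem trace_tensorPi (X : ∀ j, Matrix (B j) (B j) ℂ) :
    (tensorPi X).trace = ∏ j, (X j).trace := by
  classical
  simp only [trace, diag_apply, tensorPi_apply]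
  rw [Finset.prod_univ_sum, Fintype.piFinset_univ]

theorem tensorPi_posSemidef {X : ∀ j, Matrix (B j) (B j) ℂ} (hX : ∀ j, (X j).PosSemidef) :
    (tensorPi X).PosSemidef := by
  classical
  have h : ∀ j, ∃ Y : Matrix (B j) (B j) ℂ, X j = Yᴴ * Y := fun j => by
    open scoped MatrixOrder in
    exact CStarAlgebra.nonneg_iff_eq_star_mul_self.mp (hX j).nonneg
  choose Y hY using h
  have : tensorPi X = (tensorPi Y)ᴴ * tensorPi Y := by
    ext a b
    simp only [tensorPi_apply, hY, mul_apply, conjTranspose_apply, star_prod]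
    rw [Finset.prod_univ_sum, Fintype.piFinset_univ]
    exact Finset.sum_congr rfl fun c _ => Finset.prod_mul_distrib
  rw [this]
  exact posSemidef_conjTranspose_mul_self _

/-- Distances of product states add up, by exchanging one factor at a time. -/
theorem hasTraceNormLE_tensorPi_sub {X Y : ∀ j, Matrix (B j) (B j) ℂ} {r : Fin m → ℝ}
    (hX : ∀ j, (X j).PosSemidef) (hY : ∀ j, (Y j).PosSemidef)
    (hX1 : ∀ j, (X j).trace = 1) (hY1 : ∀ j, (Y j).trace = 1)
    (h : ∀ j, HasTraceNormLE (X j - Y j) (r j)) :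
    HasTraceNormLE (tensorPi X - tensorPi Y) (∑ j, r j) := by
  classical
  suffices H : ∀ s : Finset (Fin m),
      HasTraceNormLE (tensorPi (s.piecewise X Y) - tensorPi Y) (∑ j ∈ s, r j) by
    simpa using H Finset.univ
  intro s
  induction s using Finset.induction_on with
  | empty => simpa using HasTraceNormLE.zero
  | insert j s hj ih =>
    rw [Finset.sum_insert hj, Finset.piecewise_insert]
    set Z := s.piecewise X Y with hZ
    have hZpsd : ∀ i, (Z i).PosSemidef := fun i => by
      by_cases hi : i ∈ s <;> simp [hZ, hi, hX, hY]
    have hZ1 : ∀ i, (Z i).trace = 1 := fun i => by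
      by_cases hi : i ∈ s <;> simp [hZ, hi, hX1, hY1]
    have hZj : Z = Function.update Z j (Y j) := by
      rw [eq_comm, Function.update_eq_self_iff, hZ, Finset.piecewise_eq_of_notMem _ _ _ hj]
    have hsplit : tensorPi (Function.update Z j (X j)) - tensorPi Y =
        tensorPi (Function.update Z j (X j - Y j)) + (tensorPi Z - tensorPi Y) := by
      rw [tensorPi_update_sub, ← hZj]
      abel
    rw [hsplit]
    refine HasTraceNormLE.add ?_ ih
    obtain ⟨P, Q, hP, hQ, hPQ, hr⟩ := h j
    have hupd : ∀ W : Matrix (B j) (B j) ℂ, W.PosSemidef →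
        (tensorPi (Function.update Z j W)).PosSemidef ∧
          (tensorPi (Function.update Z j W)).trace = W.trace := fun W hW => by
      constructor
      · refine tensorPi_posSemidef fun i => ?_
        rcases eq_or_ne i j with rfl | hij
        · rwa [Function.update_self]
        · rw [Function.update_of_ne hij]
          exact hZpsd i
      · rw [trace_tensorPi, ← Finset.mul_prod_erase _ _ (Finset.mem_univ j), Function.update_self,
          Finset.prod_eq_one, mul_one]
        intro i hi
        rw [Function.update_of_ne (Finset.ne_of_mem_erase hi), hZ1]
    rw [hPQ, tensorPi_update_sub]
    refine ⟨_, _, (hupd P hP).1, (hupd Q hQ).1, rfl, ?_⟩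
    rwa [(hupd P hP).2, (hupd Q hQ).2]

end Tensor

/-! ### Partial traces and post-selection -/

theorem trace_traceFst {α η : Type*} [Fintype α] [Fintype η] (X : Matrix (α × η) (α × η) ℂ) :
    (traceFst X).trace = X.trace := by
  simp only [trace, diag_apply, traceFst, of_apply, Fintype.sum_prod_type]
  exact Finset.sum_comm

theorem traceFst_add {α η : Type*} [Fintype α] (X Y : Matrix (α × η) (α × η) ℂ) :
    traceFst (X + Y) = traceFst X + traceFst Y := by
  ext e e'
  simp [traceFst, Finset.sum_add_distrib]

theorem traceFst_smul {α η : Type*} [Fintype α] (z : ℂ) (X : Matrix (α × η) (α × η) ℂ) :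
    traceFst (z • X) = z • traceFst X := by
  ext e e'
  simp [traceFst, Finset.mul_sum]

/-- `traceFst` as a linear map. -/
def traceFstLin (α η : Type*) [Fintype α] :
    Matrix (α × η) (α × η) ℂ →ₗ[ℂ] Matrix η η ℂ where
  toFun := traceFst
  map_add' := traceFst_add
  map_smul' := traceFst_smul

theorem traceFst_posSemidef {α η : Type*} [Fintype α] [Fintype η]
    {X : Matrix (α × η) (α × η) ℂ} (hX : X.PosSemidef) : (traceFst X).PosSemidef := by
  have : traceFst X = ∑ a, X.submatrix (fun e => (a, e)) (fun e => (a, e)) := by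
    ext e e'
    simp [traceFst, Matrix.sum_apply]
  rw [this]
  exact posSemidef_sum _ fun a _ => hX.submatrix _

theorem traceFst_kronecker {α η : Type*} [Fintype α] (X : Matrix α α ℂ) (Y : Matrix η η ℂ) :
    traceFst (X ⊗ₖ Y) = X.trace • Y := by
  ext e e'
  simp [traceFst, trace, kroneckerMap_apply, Finset.sum_mul]

section

variable {α η : Type*} [Fintype α] [Fintype η] [DecidableEq η]

theorem traceFst_kronecker_one_mul_apply (M : Matrix α α ℂ) (X : Matrix (α × η) (α × η) ℂ)
    (e e' : η) : traceFst ((M ⊗ₖ (1 : Matrix η η ℂ)) * X) e e' =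
      ∑ a, ∑ b, M a b * X (b, e) (a, e') := by
  simp [traceFst, mul_apply, kroneckerMap_apply, Fintype.sum_prod_type, one_apply]

theorem traceFst_kronecker_one_mul_comm (M : Matrix α α ℂ) (X : Matrix (α × η) (α × η) ℂ) :
    traceFst ((M ⊗ₖ (1 : Matrix η η ℂ)) * X) = traceFst (X * (M ⊗ₖ (1 : Matrix η η ℂ))) := by
  ext e e'
  rw [traceFst_kronecker_one_mul_apply, Finset.sum_comm]
  simp [traceFst, mul_apply, kroneckerMap_apply, Fintype.sum_prod_type, one_apply, mul_comm]

theorem traceFst_kronecker_one_mul_posSemidef {M : Matrix α α ℂ} (hM : M.PosSemidef)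
    {X : Matrix (α × η) (α × η) ℂ} (hX : X.PosSemidef) :
    (traceFst ((M ⊗ₖ (1 : Matrix η η ℂ)) * X)).PosSemidef := by
  classical
  obtain ⟨Y, rfl⟩ : ∃ Y : Matrix α α ℂ, M = Yᴴ * Y := by
    open scoped MatrixOrder in
    exact CStarAlgebra.nonneg_iff_eq_star_mul_self.mp hM.nonneg
  have h1 : ((Yᴴ * Y) ⊗ₖ (1 : Matrix η η ℂ)) = (Yᴴ ⊗ₖ 1) * (Y ⊗ₖ 1) := by
    rw [← mul_kronecker_mul, one_mul]
  have h2 : Yᴴ ⊗ₖ (1 : Matrix η η ℂ) = (Y ⊗ₖ 1)ᴴ := by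
    rw [conjTranspose_kronecker, conjTranspose_one]
  rw [h1, Matrix.mul_assoc, traceFst_kronecker_one_mul_comm, h2]
  exact traceFst_posSemidef (hX.mul_mul_conjTranspose_same _)

theorem traceFst_ketbra_kronecker_mul_ketbra (v : α → ℂ) (ψ : α × η → ℂ) :
    traceFst ((ketbra v ⊗ₖ (1 : Matrix η η ℂ)) * ketbra ψ) =
      ketbra fun e => ∑ b, star (v b) * ψ (b, e) := by
  ext e e'
  rw [traceFst_kronecker_one_mul_apply, ketbra_apply, star_sum, Finset.sum_mul_sum,
    Finset.sum_comm]
  refine Finset.sum_congr rfl fun b _ => Finset.sum_congr rfl fun a _ => ?_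
  simp only [ketbra_apply, star_mul', star_star]
  ring

theorem traceFst_kronecker_one_mul_ketbra_prod (M : Matrix α α ℂ) (a : α → ℂ) (ξ : η → ℂ) :
    traceFst ((M ⊗ₖ (1 : Matrix η η ℂ)) * ketbra fun x : α × η => a x.1 * ξ x.2) =
      (star a ⬝ᵥ (M *ᵥ a)) • ketbra ξ := by
  ext e e'
  rw [traceFst_kronecker_one_mul_apply]
  simp only [ketbra_apply, Matrix.smul_apply, dotProduct, mulVec, Finset.sum_mul, Finset.mul_sum,
    smul_eq_mul, star_mul', Pi.star_apply]
  refine Finset.sum_congr rfl fun a _ => Finset.sum_congr rfl fun a _ => ?_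
  ring

end

section

variable {κ α η : Type*} [Fintype κ] [DecidableEq κ] [Fintype α] [Fintype η] [DecidableEq η]

theorem keptState_apply (ρ : Matrix (α × η) (α × η) ℂ) (M : κ → Matrix α α ℂ) (w : κ → ℝ)
    (k k' : κ) (e e' : η) : keptState ρ M w (k, e) (k', e') =
      if k = k' then (w k : ℂ) * ∑ a, ∑ b, M k a b * ρ (b, e) (a, e') else 0 := by
  simp only [keptState, Matrix.sum_apply, Matrix.smul_apply, kroneckerMap_apply, smul_eq_mul,
    traceFst_kronecker_one_mul_apply, single_apply]
  rw [Finset.sum_eq_single k (fun l _ hl => by simp [hl]) (fun h => absurd (Finset.mem_univ k) h)]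
  simp

/-- `keptState` as a linear map of the joint state. -/
noncomputable def keptLin (η : Type*) [Fintype η] [DecidableEq η] (M : κ → Matrix α α ℂ)
    (w : κ → ℝ) : Matrix (α × η) (α × η) ℂ →ₗ[ℂ] Matrix (κ × η) (κ × η) ℂ where
  toFun ρ := keptState ρ M w
  map_add' X Y := by
    simp only [keptState, Matrix.mul_add, traceFst_add, kronecker_add, smul_add,
      Finset.sum_add_distrib]
  map_smul' z X := by
    simp only [keptState, Matrix.mul_smul, traceFst_smul, kronecker_smul, RingHom.id_apply,
      Finset.smul_sum]
    exact Finset.sum_congr rfl fun k _ => smul_comm _ _ _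

theorem single_posSemidef {ι : Type*} [DecidableEq ι] (k : ι) :
    (single k k (1 : ℂ)).PosSemidef := by
  rw [← diagonal_single]
  refine PosSemidef.diagonal fun i => ?_
  rcases eq_or_ne i k with rfl | h
  · simp
  · simp [h]

theorem keptState_posSemidef {ρ : Matrix (α × η) (α × η) ℂ} {M : κ → Matrix α α ℂ} {w : κ → ℝ}
    (hρ : ρ.PosSemidef) (hM : ∀ k, (M k).PosSemidef) (hw : ∀ k, 0 ≤ w k) :
    (keptState ρ M w).PosSemidef :=
  posSemidef_sum _ fun k _ => posSemidef_real_smul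
    ((single_posSemidef k).kronecker (traceFst_kronecker_one_mul_posSemidef (hM k) hρ)) (hw k)

theorem trace_keptState (ρ : Matrix (α × η) (α × η) ℂ) (M : κ → Matrix α α ℂ) (w : κ → ℝ) :
    (keptState ρ M w).trace =
      ∑ k, (w k : ℂ) * (traceFst ((M k ⊗ₖ (1 : Matrix η η ℂ)) * ρ)).trace := by
  simp [keptState, trace_sum, trace_kronecker]

/-- Keeping outcomes with probabilities at most one does not increase the trace. -/
theorem re_trace_keptState_le [DecidableEq α] {ρ : Matrix (α × η) (α × η) ℂ}
    {M : κ → Matrix α α ℂ} {w : κ → ℝ} (hρ : ρ.PosSemidef) (hM : ∀ k, (M k).PosSemidef)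
    (hM1 : ∑ k, M k = 1) (hw : ∀ k, w k ≤ 1) : (keptState ρ M w).trace.re ≤ ρ.trace.re := by
  have h1 : ρ.trace = ∑ k, (traceFst ((M k ⊗ₖ (1 : Matrix η η ℂ)) * ρ)).trace := by
    have : ρ = ∑ k, (M k ⊗ₖ (1 : Matrix η η ℂ)) * ρ := by
      rw [← Finset.sum_mul]
      have h2 : ∑ k, M k ⊗ₖ (1 : Matrix η η ℂ) = (∑ k, M k) ⊗ₖ (1 : Matrix η η ℂ) := by
        ext ⟨a, e⟩ ⟨a', e'⟩
        simp [Matrix.sum_apply, kroneckerMap_apply, Finset.sum_mul]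
      rw [h2, hM1, one_kronecker_one, Matrix.one_mul]
    conv_lhs => rw [this]
    simp only [trace_sum, trace_traceFst]
  rw [h1, trace_keptState, Complex.re_sum, Complex.re_sum]
  refine Finset.sum_le_sum fun k _ => ?_
  rw [Complex.re_ofReal_mul]
  have := (Complex.nonneg_iff.mp
    (traceFst_kronecker_one_mul_posSemidef (hM k) hρ).trace_nonneg).1
  exact mul_le_of_le_one_left this (hw k)

theorem keptState_ketbra_prod (M : κ → Matrix α α ℂ) (w : κ → ℝ) (a : α → ℂ) (ξ : η → ℂ) :
    keptState (ketbra fun x : α × η => a x.1 * ξ x.2) M w =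
      ∑ k, ((w k : ℂ) * (star a ⬝ᵥ (M k *ᵥ a))) • (single k k (1 : ℂ) ⊗ₖ ketbra ξ) := by
  simp only [keptState, traceFst_kronecker_one_mul_ketbra_prod, kronecker_smul, smul_smul]

end

theorem HasTraceNormLE.traceFst {α η : Type*} [Fintype α] [Fintype η]
    {X : Matrix (α × η) (α × η) ℂ} {r : ℝ} (h : HasTraceNormLE X r) :
    HasTraceNormLE (traceFst X) r := by
  have := h.map (traceFstLin α η) zero_le_one fun P hP =>
    ⟨traceFst_posSemidef hP, by
      rw [one_mul]
      exact (congrArg Complex.re (trace_traceFst P)).le⟩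
  rwa [one_mul] at this

theorem HasTraceNormLE.abs_re_trace_le {n : Type*} [Fintype n] {X : Matrix n n ℂ} {r : ℝ}
    (h : HasTraceNormLE X r) : |X.trace.re| ≤ r := by
  obtain ⟨P, Q, hP, hQ, rfl, hr⟩ := h
  have h1 := (Complex.nonneg_iff.mp hP.trace_nonneg).1
  have h2 := (Complex.nonneg_iff.mp hQ.trace_nonneg).1
  rw [trace_sub, Complex.sub_re]
  exact abs_le.mpr ⟨by linarith, by linarith⟩

theorem HasTraceNormLE.real_smul {n : Type*} [Fintype n] {X : Matrix n n ℂ} {r : ℝ}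
    (h : HasTraceNormLE X r) {a : ℝ} (ha : 0 ≤ a) : HasTraceNormLE ((a : ℂ) • X) (a * r) := by
  obtain ⟨P, Q, hP, hQ, rfl, hr⟩ := h
  refine ⟨_, _, posSemidef_real_smul hP ha, posSemidef_real_smul hQ ha, smul_sub _ _ _, ?_⟩
  simp only [trace_smul, smul_eq_mul, Complex.re_ofReal_mul]
  nlinarith

/-! ### The cycle kernel and its Fourier diagonalization -/

theorem half_lt_cos {N : ℕ} (hN : 5 ≤ N) : 1 / 2 < Real.cos (Real.pi / N) := by
  rw [← Real.cos_pi_div_three]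
  have : (5 : ℝ) ≤ N := by exact_mod_cast hN
  apply Real.cos_lt_cos_of_nonneg_of_le_pi
  · positivity
  · linarith [Real.pi_pos]
  · exact div_lt_div_of_pos_left Real.pi_pos (by norm_num) (by linarith)

theorem cos_lt_one {N : ℕ} (hN : 5 ≤ N) : Real.cos (Real.pi / N) < 1 := by
  have : (5 : ℝ) ≤ N := by exact_mod_cast hN
  rw [← Real.cos_zero]
  apply Real.cos_lt_cos_of_nonneg_of_le_pi le_rfl
  · exact div_le_self Real.pi_pos.le (by linarith)
  · have := Real.pi_pos
    positivity

section Cycle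

variable {N : ℕ} [NeZero N] {H : Type*} [NormedAddCommGroup H] [InnerProductSpace ℂ H]

open scoped ZMod ComplexConjugate

/-- Parseval's identity for the discrete Fourier transform of vector-valued functions. -/
theorem sum_inner_dft (x y : ZMod N → H) :
    ∑ k, ⟪𝓕 x k, 𝓕 y k⟫_ℂ = N * ∑ j, ⟪x j, y j⟫_ℂ := by
  have hinv : ∀ j, ∑ k, ZMod.stdAddChar (j * k) • 𝓕 y k = (N : ℂ) • y j := fun j => by
    have h1 : 𝓕⁻ (𝓕 y) j = y j := by simp
    rw [ZMod.invDFT_apply] at h1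
    rw [← h1, smul_smul, mul_inv_cancel₀ (Nat.cast_ne_zero.mpr (NeZero.ne N)), one_smul]
    exact Finset.sum_congr rfl fun k _ => by rw [mul_comm]
  have hconj : ∀ j k : ZMod N, conj (ZMod.stdAddChar (-(j * k)) : ℂ) = ZMod.stdAddChar (j * k) :=
    fun j k => by
      rw [← AddChar.map_neg_eq_conj, neg_neg]
  calc ∑ k, ⟪𝓕 x k, 𝓕 y k⟫_ℂ
      = ∑ k, ∑ j, ZMod.stdAddChar (j * k) * ⟪x j, 𝓕 y k⟫_ℂ := by
        refine Finset.sum_congr rfl fun k _ => ?_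
        rw [ZMod.dft_apply x, sum_inner]
        exact Finset.sum_congr rfl fun j _ => by rw [inner_smul_left, hconj]
    _ = ∑ j, ⟪x j, ∑ k, ZMod.stdAddChar (j * k) • 𝓕 y k⟫_ℂ := by
        rw [Finset.sum_comm]
        refine Finset.sum_congr rfl fun j _ => ?_
        rw [inner_sum]
        exact Finset.sum_congr rfl fun k _ => by rw [inner_smul_right]
    _ = N * ∑ j, ⟪x j, y j⟫_ℂ := by
        rw [Finset.mul_sum]
        exact Finset.sum_congr rfl fun j _ => by rw [hinv, inner_smul_right]

theorem dft_shift {V : Type*} [AddCommGroup V] [Module ℂ V] (x : ZMod N → V) (a k : ZMod N) :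
    𝓕 (fun j => x (j + a)) k = (ZMod.stdAddChar (a * k) : ℂ) • 𝓕 x k := by
  rw [ZMod.dft_apply, ZMod.dft_apply, Finset.smul_sum]
  refine Fintype.sum_equiv (Equiv.addRight a) _ _ fun j => ?_
  rw [smul_smul, ← AddChar.map_add_eq_mul]
  simp only [Equiv.coe_addRight]
  congr 2
  ring

theorem dft_const_of_ne_zero {V : Type*} [AddCommGroup V] [Module ℂ V] (v : V)
    {k : ZMod N} (hk : k ≠ 0) :
    𝓕 (fun _ : ZMod N => v) k = 0 := by
  rw [ZMod.dft_apply, ← Finset.sum_smul]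
  have : ∑ j : ZMod N, (ZMod.stdAddChar (-(j * k)) : ℂ) = 0 := by
    have h := AddChar.sum_mulShift (R' := ℂ) (-k) (ZMod.isPrimitive_stdAddChar N)
    rw [if_neg (neg_ne_zero.mpr hk)] at h
    rw [← Nat.cast_zero, ← h]
    exact Finset.sum_congr rfl fun j _ => by congr 1; ring
  rw [this, zero_smul]

theorem stdAddChar_add_neg (k : ZMod N) :
    (ZMod.stdAddChar k + ZMod.stdAddChar (-k) : ℂ) =
      ((2 * Real.cos (2 * Real.pi * k.val / N) : ℝ) : ℂ) := by
  have h1 : (ZMod.stdAddChar (-k) : ℂ) = conj (ZMod.stdAddChar k : ℂ) :=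
    AddChar.map_neg_eq_conj _ _
  rw [h1, Complex.add_conj, ZMod.stdAddChar_apply, ZMod.toCircle_apply]
  have : 2 * (Real.pi : ℂ) * Complex.I * (k.val : ℂ) / N =
      ((2 * Real.pi * k.val / N : ℝ) : ℂ) * Complex.I := by
    push_cast
    ring
  rw [this, Complex.exp_ofReal_mul_I_re]

/-- The least eigenvalue of the adjacency matrix of an odd cycle is `-2 cos (π / N)`. -/
theorem neg_cos_le_cos_of_odd (hodd : Odd N) (k : ZMod N) :
    -Real.cos (Real.pi / N) ≤ Real.cos (2 * Real.pi * k.val / N) := by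
  have hN : (0 : ℝ) < N := Nat.cast_pos.mpr (NeZero.pos N)
  have hlt := ZMod.val_lt k
  obtain ⟨l, hl⟩ := hodd
  have h1 : Real.cos (2 * Real.pi * k.val / N) =
      -Real.cos |Real.pi * (N - 2 * k.val) / N| := by
    rw [Real.cos_abs, ← Real.cos_pi_sub]
    congr 1
    field_simp
    ring
  rw [h1, neg_le_neg_iff]
  have h2 : (1 : ℝ) ≤ |(N : ℝ) - 2 * k.val| := by
    have : (1 : ℤ) ≤ |(N : ℤ) - 2 * k.val| := Int.one_le_abs (by omega)
    exact_mod_cast this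
  have h3 : |(N : ℝ) - 2 * k.val| ≤ N := by
    have : |(N : ℤ) - 2 * k.val| ≤ N := abs_le.mpr ⟨by omega, by omega⟩
    exact_mod_cast this
  rw [abs_div, abs_mul, abs_of_pos Real.pi_pos, abs_of_pos hN]
  apply Real.cos_le_cos_of_nonneg_of_le_pi
  · positivity
  · rw [div_le_iff₀ hN]
    nlinarith [Real.pi_pos]
  · gcongr
    nlinarith [Real.pi_pos]

/-- The operator `1 - J / θ + A / (2c)` on vector-valued functions on the `N`-cycle, where `J` is
the all-ones matrix, `A` the adjacency matrix, `c = cos (π / N)` and `θ = N c / (1 + c)`. It is the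
optimal dual solution for the Lovász number `θ` of the odd cycle. -/
noncomputable def cycleKernel (x : ZMod N → H) (i : ZMod N) : H :=
  x i - (((1 + Real.cos (Real.pi / N)) / (N * Real.cos (Real.pi / N)) : ℝ) : ℂ) • ∑ j, x j +
    (((2 * Real.cos (Real.pi / N))⁻¹ : ℝ) : ℂ) • (x (i + -1) + x (i + 1))

/-- Eigenvalues of `cycleKernel`. -/
noncomputable def cycleEigenvalue (k : ZMod N) : ℝ :=
  if k = 0 then 0 else 1 + Real.cos (2 * Real.pi * k.val / N) / Real.cos (Real.pi / N)

theorem dft_cycleKernel (hN : 5 ≤ N) (x : ZMod N → H) (k : ZMod N) :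
    𝓕 (cycleKernel x) k = (cycleEigenvalue k : ℂ) • 𝓕 x k := by
  have hc := half_lt_cos hN
  set c := Real.cos (Real.pi / N) with hcdef
  have hN0 : (N : ℝ) ≠ 0 := Nat.cast_ne_zero.mpr (NeZero.ne N)
  have hc0 : c ≠ 0 := by linarith
  have hsplit : cycleKernel x = x - (((1 + c) / (N * c) : ℝ) : ℂ) • (fun _ => ∑ j, x j) +
      (((2 * c)⁻¹ : ℝ) : ℂ) • ((fun i => x (i + -1)) + fun i => x (i + 1)) := by
    funext i
    simp [cycleKernel, hcdef]
  rw [hsplit, map_add, map_sub, map_smul, map_smul, map_add, Pi.add_apply, Pi.sub_apply,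
    Pi.smul_apply, Pi.smul_apply, Pi.add_apply, dft_shift, dft_shift, ← add_smul, smul_smul]
  rcases eq_or_ne k 0 with rfl | hk
  · have h0 : 𝓕 (fun _ : ZMod N => ∑ j, x j) 0 = (N : ℂ) • ∑ j, x j := by
      rw [ZMod.dft_apply_zero]
      simp [ZMod.card, Nat.cast_smul_eq_nsmul]
    rw [h0, ZMod.dft_apply_zero, cycleEigenvalue, if_pos rfl, smul_smul, mul_zero, mul_zero,
      AddChar.map_zero_eq_one]
    have h1 : (((1 + c) / (N * c) : ℝ) : ℂ) * N = ((1 + c⁻¹ : ℝ) : ℂ) := by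
      rw [← Complex.ofReal_natCast, ← Complex.ofReal_mul]
      congr 1
      field_simp
      ring
    have h2 : (((2 * c)⁻¹ : ℝ) : ℂ) * (1 + 1) = ((c⁻¹ : ℝ) : ℂ) := by
      push_cast
      rw [mul_inv]
      ring
    rw [h1, h2]
    push_cast
    module
  · rw [dft_const_of_ne_zero _ hk, smul_zero, sub_zero, cycleEigenvalue, if_neg hk, ← hcdef,
      one_mul,
      show (-1 : ZMod N) * k = -k by ring, add_comm (ZMod.stdAddChar (-k) : ℂ), stdAddChar_add_neg,
      ← Complex.ofReal_mul]
    have : (2 * c)⁻¹ * (2 * Real.cos (2 * Real.pi * k.val / N)) =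
        Real.cos (2 * Real.pi * k.val / N) / c := by
      field_simp
    rw [this]
    push_cast
    module

theorem cycleEigenvalue_sq_le (hN : 5 ≤ N) (hodd : Odd N) (k : ZMod N) :
    cycleEigenvalue k ^ 2 ≤ 3 * cycleEigenvalue k := by
  rw [cycleEigenvalue]
  split_ifs with h
  · norm_num
  have hc := half_lt_cos hN
  have h1 := neg_cos_le_cos_of_odd hodd k
  have h2 := Real.cos_le_one (2 * Real.pi * k.val / N)
  set c := Real.cos (Real.pi / N)
  set d := Real.cos (2 * Real.pi * k.val / N)
  have h3 : -1 ≤ d / c := by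
    rw [le_div_iff₀ (by linarith)]
    linarith
  have h4 : d / c ≤ 2 := by
    rw [div_le_iff₀ (by linarith)]
    linarith
  nlinarith

/-- The cycle kernel `T` is positive semidefinite, in the strong form `T² ≤ 3 T`. -/
theorem sum_norm_sq_cycleKernel_le (hN : 5 ≤ N) (hodd : Odd N) (x : ZMod N → H) :
    ∑ i, ‖cycleKernel x i‖ ^ 2 ≤ 3 * ∑ i, RCLike.re ⟪x i, cycleKernel x i⟫_ℂ := by
  have hN0 : (0 : ℝ) < N := Nat.cast_pos.mpr (NeZero.pos N)
  have hre : ∀ v : H, (⟪v, v⟫_ℂ).re = ‖v‖ ^ 2 := fun v => inner_self_eq_norm_sq (𝕜 := ℂ) v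
  have h1 : (N : ℝ) * ∑ i, ‖cycleKernel x i‖ ^ 2 = ∑ k, cycleEigenvalue k ^ 2 * ‖𝓕 x k‖ ^ 2 := by
    have := congrArg Complex.re (sum_inner_dft (cycleKernel x) (cycleKernel x))
    rw [← Complex.ofReal_natCast, Complex.re_ofReal_mul, Complex.re_sum, Complex.re_sum] at this
    simp only [dft_cycleKernel hN, hre, norm_smul, Complex.norm_real, mul_pow, Real.norm_eq_abs,
      sq_abs] at this
    exact this.symm
  have h2 : (N : ℝ) * ∑ i, RCLike.re ⟪x i, cycleKernel x i⟫_ℂ =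
      ∑ k, cycleEigenvalue k * ‖𝓕 x k‖ ^ 2 := by
    have := congrArg Complex.re (sum_inner_dft x (cycleKernel x))
    rw [← Complex.ofReal_natCast, Complex.re_ofReal_mul, Complex.re_sum, Complex.re_sum] at this
    simp only [dft_cycleKernel hN, inner_smul_right, Complex.re_ofReal_mul, hre] at this
    exact this.symm
  refine le_of_mul_le_mul_left ?_ hN0
  calc (N : ℝ) * ∑ i, ‖cycleKernel x i‖ ^ 2 = ∑ k, cycleEigenvalue k ^ 2 * ‖𝓕 x k‖ ^ 2 := h1
    _ ≤ ∑ k, 3 * (cycleEigenvalue k * ‖𝓕 x k‖ ^ 2) := by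
        refine Finset.sum_le_sum fun k _ => ?_
        nlinarith [mul_le_mul_of_nonneg_right (cycleEigenvalue_sq_le hN hodd k)
          (sq_nonneg ‖𝓕 x k‖)]
    _ = N * (3 * ∑ i, RCLike.re ⟪x i, cycleKernel x i⟫_ℂ) := by
        rw [← Finset.mul_sum, ← h2]
        ring

end Cycle

/-! ### Robust self-testing of cyclically orthogonal projections -/

/-- The Lovász number of the odd `N`-cycle. -/
noncomputable def lovaszTheta (N : ℕ) : ℝ :=
  N * Real.cos (Real.pi / N) / (1 + Real.cos (Real.pi / N))

/-- Inverse of the spectral gap of `∑ Q i` on vectors annihilated by one of the projections. -/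
noncomputable def gapConst (N : ℕ) : ℝ :=
  800 / ((2 * Real.cos (Real.pi / N) - 1) * (2 - 2 * Real.cos (Real.pi / N))) ^ 2

theorem gapConst_nonneg (N : ℕ) : 0 ≤ gapConst N := by
  unfold gapConst
  positivity

theorem one_le_lovaszTheta {N : ℕ} (hN : 5 ≤ N) : 1 ≤ lovaszTheta N := by
  have hc := half_lt_cos hN
  have : (5 : ℝ) ≤ N := by exact_mod_cast hN
  rw [lovaszTheta, le_div_iff₀ (by linarith)]
  nlinarith

section CyclicProjections

variable {N : ℕ} {H : Type*} [NormedAddCommGroup H] [InnerProductSpace ℂ H]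

/-- Orthogonal projections `Q i`, `i ∈ ℤ/N`, such that cyclically adjacent ones have orthogonal
ranges. -/
structure CyclicProjections (Q : ZMod N → H →ₗ[ℂ] H) : Prop where
  symm : ∀ i x y, ⟪Q i x, y⟫_ℂ = ⟪x, Q i y⟫_ℂ
  idem : ∀ i x, Q i (Q i x) = Q i x
  orth_succ : ∀ i x, Q i (Q (i + 1) x) = 0

/-- The quadratic form of `θ - ∑ Q i`. -/
noncomputable def deficit [NeZero N] (Q : ZMod N → H →ₗ[ℂ] H) (y : H) : ℝ :=
  lovaszTheta N * ‖y‖ ^ 2 - ∑ i, ‖Q i y‖ ^ 2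

/-- The defect in the relation `Q (i - 1) y + Q (i + 1) y = 2 cos (π / N) (y - Q i y)`, which holds
exactly for vectors `y` of zero deficit. -/
noncomputable def defect (Q : ZMod N → H →ₗ[ℂ] H) (y : H) (i : ZMod N) : H :=
  Q (i + -1) y + Q (i + 1) y - ((2 * Real.cos (Real.pi / N) : ℝ) : ℂ) • (y - Q i y)

namespace CyclicProjections

variable {Q : ZMod N → H →ₗ[ℂ] H} (hQ : CyclicProjections Q)
include hQ

theorem inner_self_apply (i : ZMod N) (y : H) : ⟪y, Q i y⟫_ℂ = ((‖Q i y‖ ^ 2 : ℝ) : ℂ) := by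
  rw [← hQ.idem i y, ← hQ.symm, hQ.idem, inner_self_eq_norm_sq_to_K]
  norm_cast

theorem inner_apply_self (i : ZMod N) (y : H) : ⟪Q i y, y⟫_ℂ = ((‖Q i y‖ ^ 2 : ℝ) : ℂ) := by
  rw [hQ.symm, hQ.inner_self_apply]

theorem inner_apply_apply (i : ZMod N) (y : H) : ⟪Q i y, Q i y⟫_ℂ = ((‖Q i y‖ ^ 2 : ℝ) : ℂ) := by
  rw [hQ.symm, hQ.idem, hQ.inner_self_apply]

theorem inner_succ (i : ZMod N) (x y : H) : ⟪Q i x, Q (i + 1) y⟫_ℂ = 0 := by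
  rw [hQ.symm, hQ.orth_succ, inner_zero_right]

theorem inner_pred (i : ZMod N) (x y : H) : ⟪Q i x, Q (i + -1) y⟫_ℂ = 0 := by
  have := hQ.inner_succ (i + -1) y x
  rw [neg_add_cancel_right] at this
  rw [← inner_conj_symm, this, map_zero]

theorem orth_pred (i : ZMod N) (x : H) : Q (i + 1) (Q i x) = 0 := by
  have h : ⟪Q (i + 1) (Q i x), Q (i + 1) (Q i x)⟫_ℂ = 0 := by
    rw [hQ.symm, hQ.idem]
    exact hQ.inner_succ i _ _
  exact inner_self_eq_zero.mp h

theorem norm_apply_le (i : ZMod N) (y : H) : ‖Q i y‖ ≤ ‖y‖ := by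
  have h1 : ‖Q i y‖ ^ 2 ≤ ‖y‖ * ‖Q i y‖ := by
    have := norm_inner_le_norm (𝕜 := ℂ) y (Q i y)
    rwa [hQ.inner_self_apply, Complex.norm_real, Real.norm_eq_abs, abs_of_nonneg (by positivity)]
      at this
  rcases (norm_nonneg (Q i y)).eq_or_lt with h | h
  · rw [← h]
    positivity
  · nlinarith

/-- If `Q i y = 0` and `s = ± 1`, then `Q (i + s)` almost fixes `y`: the defect relation at `i + s`
reads `Q (i + 2 s) y ≈ 2 c (y - Q (i + s) y)`, and applying `Q (i + 2 s)` to it forces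
`Q (i + 2 s) y` to be small because `2 c > 1`. To cover both signs, `a` stands for `Q (i + s) y`, `j` for `i + 2 s`
and `d` for the defect. -/
theorem norm_sub_apply_le (hN : 5 ≤ N) {y a b d : H} {n : ℝ} (hn : ‖d‖ ≤ n)
    {j : ZMod N} (hb : b = Q j y) (hba : Q j a = 0)
    (hd : d = b - ((2 * Real.cos (Real.pi / N) : ℝ) : ℂ) • (y - a)) :
    (2 * Real.cos (Real.pi / N) - 1) * ‖y - a‖ ≤ 2 * n := by
  have hc := half_lt_cos hN
  have hc1 := Real.cos_le_one (Real.pi / N)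
  set c := Real.cos (Real.pi / N) with hcdef
  have h1 : Q j d = ((1 - 2 * c : ℝ) : ℂ) • b := by
    rw [hd, map_sub, map_smul, map_sub, hba, hb, hQ.idem]
    push_cast
    module
  have h2 : (2 * c - 1) * ‖b‖ ≤ n := by
    have := (hQ.norm_apply_le j d).trans hn
    rw [h1, norm_smul, Complex.norm_real, Real.norm_eq_abs, abs_sub_comm,
      abs_of_pos (by linarith)] at this
    exact this
  have h3 : 2 * c * ‖y - a‖ ≤ ‖b‖ + n := by
    have h4 : ((2 * c : ℝ) : ℂ) • (y - a) = b - d := by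
      rw [hd]
      abel
    have h5 := norm_sub_le b d
    rw [← h4, norm_smul, Complex.norm_real, Real.norm_eq_abs, abs_of_pos (by linarith)] at h5
    linarith
  have h6 := norm_nonneg (y - a)
  have h7 := norm_nonneg b
  have h8 := (norm_nonneg d).trans hn
  nlinarith [mul_le_mul_of_nonneg_left h3 (by linarith : 0 ≤ 2 * c - 1)]

variable [NeZero N]

/-- The sum-of-squares decomposition of the deficit. -/
theorem deficit_eq (hN : 5 ≤ N) (y : H) :
    deficit Q y = (lovaszTheta N)⁻¹ * ‖((lovaszTheta N : ℝ) : ℂ) • y - ∑ i, Q i y‖ ^ 2 +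
      ∑ i, RCLike.re ⟪Q i y, cycleKernel (fun j => Q j y) i⟫_ℂ := by
  have hθ : lovaszTheta N ≠ 0 := by linarith [one_le_lovaszTheta hN]
  have hθi : (1 + Real.cos (Real.pi / N)) / (N * Real.cos (Real.pi / N)) = (lovaszTheta N)⁻¹ := by
    rw [lovaszTheta, inv_div]
  set θ := lovaszTheta N with hθdef
  set s := ∑ i, Q i y with hs
  have h1 : RCLike.re ⟪y, s⟫_ℂ = ∑ i, ‖Q i y‖ ^ 2 := by
    rw [hs, inner_sum, map_sum]
    exact Finset.sum_congr rfl fun i _ => by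
      rw [hQ.inner_self_apply]
      exact Complex.ofReal_re _
  have h2 : ∀ i, RCLike.re ⟪Q i y, cycleKernel (fun j => Q j y) i⟫_ℂ =
      ‖Q i y‖ ^ 2 - θ⁻¹ * RCLike.re ⟪Q i y, s⟫_ℂ := fun i => by
    rw [cycleKernel, hθi, inner_add_right, inner_sub_right, inner_smul_right, inner_smul_right,
      inner_add_right, hQ.inner_pred, hQ.inner_succ, add_zero, mul_zero, add_zero, map_sub,
      inner_self_eq_norm_sq (𝕜 := ℂ)]
    congr 1
    exact Complex.re_ofReal_mul _ _
  have h3 : ∑ i, RCLike.re ⟪Q i y, s⟫_ℂ = ‖s‖ ^ 2 := by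
    rw [← map_sum, ← sum_inner, ← hs, inner_self_eq_norm_sq (𝕜 := ℂ)]
  have h4 : ‖((θ : ℝ) : ℂ) • y - s‖ ^ 2 = θ ^ 2 * ‖y‖ ^ 2 - 2 * θ * RCLike.re ⟪y, s⟫_ℂ +
      ‖s‖ ^ 2 := by
    rw [@norm_sub_sq ℂ, inner_smul_left, norm_smul, mul_pow, Complex.norm_real, Real.norm_eq_abs,
      sq_abs, Complex.conj_ofReal]
    have : RCLike.re ((θ : ℂ) * ⟪y, s⟫_ℂ) = θ * RCLike.re ⟪y, s⟫_ℂ := Complex.re_ofReal_mul _ _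
    rw [this]
    ring
  rw [Finset.sum_congr rfl fun i _ => h2 i, Finset.sum_sub_distrib, ← Finset.mul_sum, h3, h4, h1,
    deficit, ← hθdef]
  field_simp
  ring

theorem sum_norm_sq_kernel_le (hN : 5 ≤ N) (hodd : Odd N) (y : H) :
    ∑ i, ‖cycleKernel (fun j => Q j y) i‖ ^ 2 ≤ 3 * deficit Q y ∧
      ‖((lovaszTheta N : ℝ) : ℂ) • y - ∑ i, Q i y‖ ^ 2 ≤ lovaszTheta N * deficit Q y := by
  have hθ := one_le_lovaszTheta hN
  have h1 := sum_norm_sq_cycleKernel_le hN hodd fun j => Q j y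
  have h2 := hQ.deficit_eq hN y
  have h3 : 0 ≤ ∑ i, ‖cycleKernel (fun j => Q j y) i‖ ^ 2 := by positivity
  have h4 : 0 ≤ (lovaszTheta N)⁻¹ * ‖((lovaszTheta N : ℝ) : ℂ) • y - ∑ i, Q i y‖ ^ 2 := by
    positivity
  refine ⟨by linarith, ?_⟩
  rw [← inv_mul_le_iff₀ (by linarith)]
  linarith

theorem deficit_nonneg (hN : 5 ≤ N) (hodd : Odd N) (y : H) : 0 ≤ deficit Q y := by
  have h1 := (hQ.sum_norm_sq_kernel_le hN hodd y).1
  have h3 : 0 ≤ ∑ i, ‖cycleKernel (fun j => Q j y) i‖ ^ 2 := by positivity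
  linarith

theorem norm_defect_sq_le (hN : 5 ≤ N) (hodd : Odd N) (y : H) (i : ZMod N) :
    ‖defect Q y i‖ ^ 2 ≤ 32 * deficit Q y := by
  obtain ⟨h1, h2⟩ := hQ.sum_norm_sq_kernel_le hN hodd y
  have hc := half_lt_cos hN
  have hc1 := Real.cos_le_one (Real.pi / N)
  have hθ := one_le_lovaszTheta hN
  have h3 : ‖cycleKernel (fun j => Q j y) i‖ ^ 2 ≤ 3 * deficit Q y :=
    (Finset.single_le_sum (f := fun i => ‖cycleKernel (fun j => Q j y) i‖ ^ 2)
      (fun i _ => by positivity) (Finset.mem_univ i)).trans h1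
  have hθi : (1 + Real.cos (Real.pi / N)) / (N * Real.cos (Real.pi / N)) = (lovaszTheta N)⁻¹ := by
    rw [lovaszTheta, inv_div]
  set c := Real.cos (Real.pi / N) with hcdef
  set θ := lovaszTheta N with hθdef
  set T := cycleKernel (fun j => Q j y) i with hT
  set R := ((θ : ℝ) : ℂ) • y - ∑ i, Q i y with hR
  have hc0 : (c : ℂ) ≠ 0 := by
    have : c ≠ 0 := by linarith
    exact_mod_cast this
  have hθ0 : (θ : ℂ) ≠ 0 := by
    have : θ ≠ 0 := by linarith
    exact_mod_cast this
  have h4 : defect Q y i = ((2 * c : ℝ) : ℂ) • (T - ((θ⁻¹ : ℝ) : ℂ) • R) := by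
    have e1 : ((2 * c : ℝ) : ℂ) * (((2 * c)⁻¹ : ℝ) : ℂ) = 1 := by
      push_cast
      field_simp
    have e2 : ((θ⁻¹ : ℝ) : ℂ) * (θ : ℂ) = 1 := by
      push_cast
      field_simp
    rw [hT, hR, cycleKernel, hθi, defect, ← hcdef]
    simp only [smul_sub, smul_add, smul_smul, e1, e2, one_smul]
    module
  have h5 : ‖((θ⁻¹ : ℝ) : ℂ) • R‖ ^ 2 ≤ deficit Q y := by
    have hD := hQ.deficit_nonneg hN hodd y
    rw [norm_smul, mul_pow, Complex.norm_real, Real.norm_eq_abs, sq_abs, inv_pow,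
      inv_mul_le_iff₀ (by positivity)]
    nlinarith
  have h6 : ‖T - ((θ⁻¹ : ℝ) : ℂ) • R‖ ^ 2 ≤ 8 * deficit Q y := by
    have := norm_sub_le T (((θ⁻¹ : ℝ) : ℂ) • R)
    have hn := norm_nonneg (T - ((θ⁻¹ : ℝ) : ℂ) • R)
    nlinarith [sq_nonneg (‖T‖ - ‖((θ⁻¹ : ℝ) : ℂ) • R‖)]
  rw [h4, norm_smul, mul_pow, Complex.norm_real, Real.norm_eq_abs, sq_abs]
  have hD := hQ.deficit_nonneg hN hodd y
  have hc4 : (2 * c) ^ 2 ≤ 4 := by nlinarith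
  nlinarith [mul_le_mul_of_nonneg_right hc4 (sq_nonneg ‖T - ((θ⁻¹ : ℝ) : ℂ) • R‖)]

theorem norm_defect_le (hN : 5 ≤ N) (hodd : Odd N) (y : H) (i : ZMod N) :
    ‖defect Q y i‖ ≤ √(32 * deficit Q y) :=
  Real.le_sqrt_of_sq_le (hQ.norm_defect_sq_le hN hodd y i)

/-- Spectral gap: a vector annihilated by one of the projections has a large deficit. -/
theorem norm_sq_le_of_apply_eq_zero (hN : 5 ≤ N) (hodd : Odd N) {y : H} {i : ZMod N}
    (hy : Q i y = 0) : ‖y‖ ^ 2 ≤ gapConst N * deficit Q y := by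
  have hc := half_lt_cos hN
  have hc1 := cos_lt_one hN
  have hD := hQ.deficit_nonneg hN hodd y
  have hn := hQ.norm_defect_le hN hodd y
  set n := √(32 * deficit Q y) with hndef
  have hn0 : 0 ≤ n := Real.sqrt_nonneg _
  have h1 := hQ.norm_sub_apply_le hN (hn (i + 1)) (y := y) (a := Q (i + 1) y) (j := i + 1 + 1) rfl
    (hQ.orth_pred _ _) (by rw [defect, add_neg_cancel_right, hy, zero_add])
  have h2 := hQ.norm_sub_apply_le hN (hn (i + -1)) (y := y) (a := Q (i + -1) y) (j := i + -1 + -1)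
    rfl (by
      have := hQ.orth_succ (i + -1 + -1) y
      rwa [neg_add_cancel_right] at this)
    (by rw [defect, neg_add_cancel_right, hy, add_zero])
  set c := Real.cos (Real.pi / N) with hcdef
  have h3 : (2 - 2 * c) * ‖y‖ ≤ ‖y - Q (i + 1) y‖ + ‖y - Q (i + -1) y‖ + n := by
    have h4 : ((2 - 2 * c : ℝ) : ℂ) • y =
        (y - Q (i + 1) y) + (y - Q (i + -1) y) + defect Q y i := by
      rw [defect, hy, ← hcdef]
      push_cast
      module
    have h5 := norm_add₃_le (a := y - Q (i + 1) y) (b := y - Q (i + -1) y) (c := defect Q y i)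
    rw [← h4, norm_smul, Complex.norm_real, Real.norm_eq_abs, abs_of_pos (by linarith)] at h5
    linarith [hn i]
  set g := (2 * c - 1) * (2 - 2 * c) with hg
  have hg0 : 0 < g := mul_pos (by linarith) (by linarith)
  have h6 : g * ‖y‖ ≤ 5 * n := by
    have := mul_le_mul_of_nonneg_left h3 (by linarith : 0 ≤ 2 * c - 1)
    rw [hg]
    nlinarith
  have h7 : n ^ 2 = 32 * deficit Q y := Real.sq_sqrt (by linarith)
  have h8 : (g * ‖y‖) ^ 2 ≤ (5 * n) ^ 2 := pow_le_pow_left₀ (by positivity) h6 2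
  rw [gapConst, ← hcdef, ← hg, div_mul_eq_mul_div, le_div_iff₀ (by positivity)]
  nlinarith

/-- If a projection `F` commutes with all `Q i` and fixes `Q i y` for one `i`, then `F` fixes `y` up
to the deficit. -/
theorem norm_sub_sq_le_of_commute (hN : 5 ≤ N) (hodd : Odd N) (F : H →ₗ[ℂ] H)
    (hFs : ∀ x z, ⟪F x, z⟫_ℂ = ⟪x, F z⟫_ℂ) (hFi : ∀ x, F (F x) = F x)
    (hFQ : ∀ i x, F (Q i x) = Q i (F x)) {y : H} {i : ZMod N} (hy : F (Q i y) = Q i y) :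
    ‖y - F y‖ ^ 2 ≤ gapConst N * deficit Q y := by
  have hpyth : ∀ z, ‖z‖ ^ 2 = ‖F z‖ ^ 2 + ‖z - F z‖ ^ 2 := fun z => by
    have h0 : ⟪F z, z - F z⟫_ℂ = 0 := by
      rw [hFs, map_sub, hFi, sub_self, inner_zero_right]
    have := norm_add_sq_eq_norm_sq_add_norm_sq_of_inner_eq_zero (F z) (z - F z) h0
    rw [add_sub_cancel] at this
    simpa only [sq] using this
  have h1 : Q i (y - F y) = 0 := by
    rw [map_sub, ← hFQ, hy, sub_self]
  have h2 : deficit Q y = deficit Q (F y) + deficit Q (y - F y) := by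
    have h3 : ∀ j, ‖Q j y‖ ^ 2 = ‖Q j (F y)‖ ^ 2 + ‖Q j (y - F y)‖ ^ 2 := fun j => by
      rw [hpyth (Q j y), hFQ, map_sub]
    rw [deficit, deficit, deficit, hpyth y, Finset.sum_congr rfl fun j _ => h3 j,
      Finset.sum_add_distrib]
    ring
  have h4 := hQ.deficit_nonneg hN hodd (F y)
  have h5 := hQ.norm_sq_le_of_apply_eq_zero hN hodd h1
  exact h5.trans (mul_le_mul_of_nonneg_left (by linarith) (gapConst_nonneg N))

/-- All probabilities are close to the optimal value `c / (1 + c)`. Pairing the defect relation at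
`i` with `Q (i + 1) y` and with `Q (i - 1) y` shows that the probabilities at `i + 1` and at `i - 1`
are close; as `N` is odd, all of them are close to each other, and the relation paired with `y`
determines their common value. -/
theorem abs_prob_sub_le (hN : 5 ≤ N) (hodd : Odd N) {y : H} (hy : ‖y‖ = 1) (i : ZMod N) :
    |(1 + Real.cos (Real.pi / N)) * ‖Q i y‖ ^ 2 - Real.cos (Real.pi / N)| ≤
      (1 + 4 * N / (2 * Real.cos (Real.pi / N) - 1)) * √(32 * deficit Q y) := by
  have hc := half_lt_cos hN
  have hn := hQ.norm_defect_le hN hodd y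
  set n := √(32 * deficit Q y) with hndef
  have hn0 : 0 ≤ n := Real.sqrt_nonneg _
  set c := Real.cos (Real.pi / N) with hcdef
  set t : ZMod N → ℝ := fun j => ‖Q j y‖ ^ 2 with ht
  have hQ1 : ∀ j, ‖Q j y‖ ≤ 1 := fun j => hy ▸ hQ.norm_apply_le j y
  have hbd : ∀ j (x : H), ‖x‖ ≤ 1 → |(⟪x, defect Q y j⟫_ℂ).re| ≤ n := fun j x hx =>
    (Complex.abs_re_le_norm _).trans ((norm_inner_le_norm _ _).trans (by
      nlinarith [hn j, norm_nonneg x, norm_nonneg (defect Q y j)]))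
  have hstep : ∀ j, |t (j + 1 + 1) - t j| ≤ 2 * n / (2 * c - 1) := fun j => by
    have e1 : (⟪Q (j + 1 + 1) y, defect Q y (j + 1)⟫_ℂ).re =
        (⟪Q (j + 1 + 1) y, Q j y⟫_ℂ).re + (1 - 2 * c) * t (j + 1 + 1) := by
      have h0 : ⟪Q (j + 1 + 1) y, Q (j + 1) y⟫_ℂ = 0 := by
        have := hQ.inner_pred (j + 1 + 1) y y
        rwa [add_neg_cancel_right] at this
      rw [defect, ← hcdef, add_neg_cancel_right, inner_sub_right, inner_add_right,
        inner_smul_right, inner_sub_right, h0, sub_zero, hQ.inner_apply_self,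
        hQ.inner_apply_apply, Complex.sub_re, Complex.add_re, Complex.re_ofReal_mul,
        Complex.ofReal_re]
      ring
    have e2 : (⟪Q j y, defect Q y (j + 1)⟫_ℂ).re =
        (⟪Q (j + 1 + 1) y, Q j y⟫_ℂ).re + (1 - 2 * c) * t j := by
      rw [← inner_conj_symm (Q (j + 1 + 1) y), Complex.conj_re, defect, ← hcdef,
        add_neg_cancel_right, inner_sub_right, inner_add_right, inner_smul_right, inner_sub_right,
        hQ.inner_succ, sub_zero, hQ.inner_apply_self, hQ.inner_apply_apply, Complex.sub_re,
        Complex.add_re, Complex.re_ofReal_mul, Complex.ofReal_re]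
      ring
    have b1 := abs_le.mp (hbd (j + 1) (Q (j + 1 + 1) y) (hQ1 _))
    have b2 := abs_le.mp (hbd (j + 1) (Q j y) (hQ1 _))
    rw [le_div_iff₀ (by linarith), ← abs_of_pos (by linarith : 0 < 2 * c - 1), ← abs_mul]
    rw [e1] at b1
    rw [e2] at b2
    exact abs_le.mpr ⟨by linarith, by linarith⟩
  have hmul : ∀ (l : ℕ) (j : ZMod N), |t (j + (2 * l : ℕ)) - t j| ≤ l * (2 * n / (2 * c - 1)) := by
    intro l j
    induction l with
    | zero => simp
    | succ l ih =>
      have h1 := hstep (j + (2 * l : ℕ))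
      have h2 : j + ((2 * (l + 1) : ℕ) : ZMod N) = j + (2 * l : ℕ) + 1 + 1 := by
        push_cast
        ring
      rw [h2]
      have h3 := abs_sub_le (t (j + (2 * l : ℕ) + 1 + 1)) (t (j + (2 * l : ℕ))) (t j)
      push_cast at *
      linarith
  set D := N * (2 * n / (2 * c - 1)) with hD
  have hD0 : 0 ≤ 2 * n / (2 * c - 1) := div_nonneg (by linarith) (by linarith)
  have hsucc : ∀ j, |t (j + 1) - t j| ≤ D := fun j => by
    obtain ⟨l, hl⟩ := hodd
    have h1 := hmul (l + 1) j
    have h2 : ((2 * (l + 1) : ℕ) : ZMod N) = 1 := by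
      rw [show 2 * (l + 1) = N + 1 by omega, Nat.cast_add, ZMod.natCast_self, zero_add,
        Nat.cast_one]
    rw [h2] at h1
    refine h1.trans (mul_le_mul_of_nonneg_right ?_ hD0)
    exact_mod_cast (by omega : l + 1 ≤ N)
  have e3 : (⟪y, defect Q y i⟫_ℂ).re = t (i + -1) + t (i + 1) - 2 * c * (1 - t i) := by
    have h0 : ⟪y, y⟫_ℂ = ((1 : ℝ) : ℂ) := by
      rw [inner_self_eq_norm_sq_to_K, hy]
      simp
    rw [defect, ← hcdef, inner_sub_right, inner_add_right, inner_smul_right, inner_sub_right,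
      hQ.inner_self_apply, hQ.inner_self_apply, hQ.inner_self_apply, h0, ← Complex.ofReal_sub,
      ← Complex.ofReal_mul, ← Complex.ofReal_add, ← Complex.ofReal_sub, Complex.ofReal_re]
  have b3 := abs_le.mp (hbd i y hy.le)
  have b4 := abs_le.mp (hsucc i)
  have b5 := abs_le.mp (hsucc (i + -1))
  rw [neg_add_cancel_right] at b5
  rw [e3] at b3
  have hfin : (1 + 4 * N / (2 * c - 1)) * n = n + 2 * D := by
    rw [hD]
    ring
  have hD1 : 0 ≤ D := mul_nonneg (Nat.cast_nonneg _) hD0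
  rw [hfin]
  exact abs_le.mpr ⟨by nlinarith, by nlinarith⟩

end CyclicProjections

end CyclicProjections

/-! ### The quantum value of the odd cycle -/

section Value

variable {α : Type*} [Fintype α] [DecidableEq α]

theorem seqProb_one_zero {P Q : Matrix α α ℂ} (ρ : Matrix α α ℂ) (hP : P * P = P) (hQ : Q * Q = Q)
    (hPQ : Commute P Q) : seqProb ρ P Q 1 0 = (ρ * (P * (1 - Q))).trace.re := by
  have hQ' : (1 - Q) * (1 - Q) = 1 - Q := by
    rw [Matrix.mul_sub, Matrix.sub_mul, Matrix.sub_mul, hQ]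
    simp
  have hc : (1 - Q) * P = P * (1 - Q) := by
    rw [Matrix.mul_sub, Matrix.sub_mul, hPQ.eq]
    simp
  have h0 : effect Q 0 = 1 - Q := by simp [effect]
  have h1 : effect P 1 = P := by simp [effect]
  rw [seqProb, h0, h1]
  congr 1
  calc ((1 - Q) * (P * ρ * P) * (1 - Q)).trace
      = ((P * ρ * P) * ((1 - Q) * (1 - Q))).trace := by
        rw [Matrix.mul_assoc, trace_mul_comm, Matrix.mul_assoc]
    _ = (P * (ρ * (P * (1 - Q)))).trace := by
        rw [hQ', Matrix.mul_assoc, Matrix.mul_assoc]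
    _ = (ρ * (P * ((1 - Q) * P))).trace := by
        rw [trace_mul_comm]
        simp only [Matrix.mul_assoc]
    _ = (ρ * (P * (1 - Q))).trace := by
        rw [hc, ← Matrix.mul_assoc P, hP]

theorem re_trace_mul_nonneg {n : Type*} [Fintype n] {ρ R : Matrix n n ℂ}
    (hρ : ρ.PosSemidef) (hR : R.IsHermitian) (hRR : R * R = R) : 0 ≤ (ρ * R).trace.re := by
  have h : (ρ * R).trace = (R * ρ * Rᴴ).trace := by
    rw [hR.eq, trace_mul_comm (R * ρ), ← Matrix.mul_assoc, hRR, trace_mul_comm]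
  rw [h]
  exact (Complex.nonneg_iff.mp (hρ.mul_mul_conjTranspose_same R).trace_nonneg).1

/-- The event `P = 1` followed by `Q = 0`, for commuting projections, is itself a projection. -/
theorem isHermitian_mul_one_sub {P Q : Matrix α α ℂ} (hP : P.IsHermitian) (hQ : Q.IsHermitian)
    (hPQ : Commute P Q) : (P * (1 - Q)).IsHermitian := by
  rw [IsHermitian, conjTranspose_mul, hP.eq, conjTranspose_sub, hQ.eq, conjTranspose_one,
    Matrix.mul_sub, Matrix.sub_mul, hPQ.eq]
  simp

theorem mul_one_sub_mul_self {P Q : Matrix α α ℂ} (hP : P * P = P) (hQ : Q * Q = Q)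
    (hPQ : Commute P Q) : P * (1 - Q) * (P * (1 - Q)) = P * (1 - Q) := by
  have h1 : Q * P = P * Q := hPQ.eq.symm
  have h2 : P * (1 - Q) = P - P * Q := by
    rw [Matrix.mul_sub, Matrix.mul_one]
  have h3 : P * Q * P = P * Q := by
    rw [Matrix.mul_assoc, h1, ← Matrix.mul_assoc, hP]
  have h4 : P * Q * (P * Q) = P * Q := by
    rw [← Matrix.mul_assoc, h3, Matrix.mul_assoc, hQ]
  have h5 : P * (P * Q) = P * Q := by
    rw [← Matrix.mul_assoc, hP]
  rw [h2, Matrix.sub_mul, Matrix.mul_sub, Matrix.mul_sub, hP, h3, h4, h5]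
  simp

theorem IsRealization.ncValue_le {N : ℕ} [NeZero N] {ρ : Matrix α α ℂ}
    {P : ZMod N → Matrix α α ℂ} (h : IsRealization ρ P) : ncValue ρ P ≤ N := by
  have h1 : ∀ i, seqProb ρ (P i) (P (i + 1)) 1 0 ≤ 1 := fun i => by
    rw [seqProb_one_zero ρ (h.idempotent i) (h.idempotent (i + 1)) (h.compatible i)]
    have hH := isHermitian_mul_one_sub (h.hermitian i) (h.hermitian (i + 1)) (h.compatible i)
    have hI := mul_one_sub_mul_self (h.idempotent i) (h.idempotent (i + 1)) (h.compatible i)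
    set R := P i * (1 - P (i + 1))
    have hR' : (1 - R) * (1 - R) = 1 - R := by
      rw [Matrix.mul_sub, Matrix.sub_mul, Matrix.sub_mul, hI]
      simp
    have h2 := re_trace_mul_nonneg h.state_psd (isHermitian_one.sub hH) hR'
    rw [Matrix.mul_sub, Matrix.mul_one, trace_sub, Complex.sub_re, h.state_trace,
      Complex.one_re] at h2
    linarith
  calc ncValue ρ P ≤ ∑ _i : ZMod N, (1 : ℝ) := Finset.sum_le_sum fun i _ => h1 i
    _ = N := by simp [ZMod.card]

end Value

theorem ketbra_mul_ketbra {n : Type*} [Fintype n] (u w : n → ℂ) :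
    ketbra u * ketbra w = (star u ⬝ᵥ w) • vecMulVec u (star w) := by
  rw [ketbra, ketbra, vecMulVec_mul_vecMulVec, vecMulVec_smul]

/-- Angles of the optimal vectors: consecutive ones differ by `π - π / N` modulo `2π`, which closes
up after `N` steps because `N` is odd. -/
theorem cos_angle_sub {N : ℕ} [NeZero N] (hodd : Odd N) (i : ZMod N) :
    Real.cos ((Real.pi - Real.pi / N) * (i + 1).val - (Real.pi - Real.pi / N) * i.val) =
      -Real.cos (Real.pi / N) := by
  have hN0 : (N : ℝ) ≠ 0 := Nat.cast_ne_zero.mpr (NeZero.ne N)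
  by_cases h : i.val + 1 < N
  · have hN1 : 1 < N := by omega
    have : Fact (1 < N) := ⟨hN1⟩
    have h1 : (i + 1).val = i.val + 1 := by
      rw [ZMod.val_add_of_lt] <;> rw [ZMod.val_one]
      exact h
    rw [h1, ← Real.cos_pi_sub]
    congr 1
    push_cast
    ring
  · have hlt := ZMod.val_lt i
    have hi : i.val + 1 = N := by omega
    have h1 : i + 1 = 0 := by
      rw [← ZMod.natCast_zmod_val i, ← Nat.cast_one, ← Nat.cast_add, hi, ZMod.natCast_self]
    obtain ⟨l, hl⟩ := hodd
    have h2 : (i.val : ℝ) = N - 1 := by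
      rw [eq_sub_iff_add_eq]
      exact_mod_cast hi
    have h3 : (N : ℝ) = 2 * l + 1 := by exact_mod_cast hl
    have h4 : (Real.pi - Real.pi / N) * (N - 1) = Real.pi / N - Real.pi + l * (2 * Real.pi) := by
      have : (Real.pi - Real.pi / N) * (N - 1) = Real.pi * N - 2 * Real.pi + Real.pi / N := by
        field_simp
        ring
      rw [this, h3]
      ring
    rw [h1, ZMod.val_zero, Nat.cast_zero, mul_zero, zero_sub, Real.cos_neg, h2, h4,
      Real.cos_add_nat_mul_two_pi, Real.cos_sub_pi]

/-- The vectors of a regular umbrella in `ℝ³` around the first axis with `N` ribs and opening such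
that ribs `i` and `i + 1` are orthogonal. -/
noncomputable def umbrella (N : ℕ) (i : ZMod N) : Fin 3 → ℂ :=
  let q := Real.cos (Real.pi / N) / (1 + Real.cos (Real.pi / N))
  let a := (Real.pi - Real.pi / N) * i.val
  fun j => ((![√q, √(1 - q) * Real.cos a, √(1 - q) * Real.sin a] j : ℝ) : ℂ)

theorem star_umbrella_dotProduct {N : ℕ} (hN : 5 ≤ N) (i j : ZMod N) :
    star (umbrella N i) ⬝ᵥ umbrella N j =
      (((Real.cos (Real.pi / N) + Real.cos ((Real.pi - Real.pi / N) * j.val -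
        (Real.pi - Real.pi / N) * i.val)) / (1 + Real.cos (Real.pi / N)) : ℝ) : ℂ) := by
  have hc := half_lt_cos hN
  simp only [umbrella, dotProduct, Fin.sum_univ_three, Pi.star_apply, RCLike.star_def,
    Complex.conj_ofReal, ← Complex.ofReal_mul, ← Complex.ofReal_add]
  congr 1
  rw [Real.cos_sub]
  set c := Real.cos (Real.pi / N)
  have h1 : √(c / (1 + c)) * √(c / (1 + c)) = c / (1 + c) :=
    Real.mul_self_sqrt (div_nonneg (by linarith) (by linarith))
  have h3 : 1 - c / (1 + c) = 1 / (1 + c) := by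
    have : 1 + c ≠ 0 := by linarith
    field_simp
    ring
  have h2 : √(1 - c / (1 + c)) * √(1 - c / (1 + c)) = 1 / (1 + c) := by
    rw [h3]
    exact Real.mul_self_sqrt (div_nonneg zero_le_one (by linarith))
  simp only [Matrix.cons_val_zero, Matrix.cons_val_one, Matrix.cons_val]
  linear_combination h1 + (Real.cos ((Real.pi - Real.pi / N) * i.val) *
    Real.cos ((Real.pi - Real.pi / N) * j.val) + Real.sin ((Real.pi - Real.pi / N) * i.val) *
    Real.sin ((Real.pi - Real.pi / N) * j.val)) * h2

theorem isUnitVec_iff {ι : Type*} [Fintype ι] (u : ι → ℂ) : IsUnitVec u ↔ star u ⬝ᵥ u = 1 := by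
  have : star u ⬝ᵥ u = (ketbra u).trace := by
    rw [ketbra, trace_vecMulVec, dotProduct_comm]
  rw [this, trace_ketbra, IsUnitVec]
  exact_mod_cast Iff.rfl

theorem lovaszTheta_le_betaQT {N : ℕ} [NeZero N] (hN : 5 ≤ N) (hodd : Odd N) :
    lovaszTheta N ≤ betaQT N := by
  have hc := half_lt_cos hN
  have hunit : ∀ i, IsUnitVec (umbrella N i) := fun i => by
    rw [isUnitVec_iff, star_umbrella_dotProduct hN, sub_self, Real.cos_zero, add_comm,
      div_self (by linarith), Complex.ofReal_one]
  have horth : ∀ i, ketbra (umbrella N i) * ketbra (umbrella N (i + 1)) = 0 := fun i => by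
    rw [ketbra_mul_ketbra, star_umbrella_dotProduct hN, cos_angle_sub hodd]
    simp
  have horth' : ∀ i, ketbra (umbrella N (i + 1)) * ketbra (umbrella N i) = 0 := fun i => by
    have := congrArg conjTranspose (horth i)
    rwa [conjTranspose_mul, (ketbra_isHermitian _).eq, (ketbra_isHermitian _).eq,
      conjTranspose_zero] at this
  have hcomm : ∀ i, Commute (ketbra (umbrella N i)) (ketbra (umbrella N (i + 1))) := fun i =>
    (horth i).trans (horth' i).symm
  have he : IsUnitVec (Pi.single 0 1 : Fin 3 → ℂ) := by
    simp [isUnitVec_iff]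
  refine le_csSup ⟨N, ?_⟩ ⟨3, ketbra (Pi.single 0 1), fun i => ketbra (umbrella N i), ?_, ?_⟩
  · rintro b ⟨d, ρ, P, hR, rfl⟩
    exact hR.ncValue_le
  · exact ⟨ketbra_posSemidef _, he.trace_ketbra, fun i => ketbra_isHermitian _,
      fun i => (hunit i).ketbra_mul_self, hcomm⟩
  · have hprob : ∀ i, seqProb (ketbra (Pi.single 0 1)) (ketbra (umbrella N i))
        (ketbra (umbrella N (i + 1))) 1 0 =
          Real.cos (Real.pi / N) / (1 + Real.cos (Real.pi / N)) := fun i => by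
      rw [seqProb_one_zero _ (hunit i).ketbra_mul_self (hunit (i + 1)).ketbra_mul_self (hcomm i),
        Matrix.mul_sub, horth, sub_zero, Matrix.mul_one, ketbra_mul_ketbra, trace_smul,
        trace_vecMulVec]
      have h0 : umbrella N i 0 =
          ((√(Real.cos (Real.pi / N) / (1 + Real.cos (Real.pi / N))) : ℝ) : ℂ) := by
        simp [umbrella]
      simp only [← Pi.single_star, star_one, single_one_dotProduct, Pi.star_apply, h0,
        RCLike.star_def, Complex.conj_ofReal, smul_eq_mul, ← Complex.ofReal_mul,
        Complex.ofReal_re]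
      exact Real.mul_self_sqrt (div_nonneg (by linarith) (by linarith))
    rw [ncValue, Finset.sum_congr rfl fun i _ => hprob i, lovaszTheta]
    simp [ZMod.card]
    ring

/-! ### The cyclic projections of a strategy -/

/-- Commuting rank-one projections are orthogonal or equal. -/
theorem ketbra_mul_one_sub_ketbra {α : Type*} [Fintype α] [DecidableEq α] {u w : α → ℂ}
    (hw : IsUnitVec w) (h : Commute (ketbra u) (ketbra w)) :
    ketbra u * (1 - ketbra w) = ketbra u ∨ ketbra u * (1 - ketbra w) = 0 := by
  set z := star u ⬝ᵥ w with hz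
  have h1 : ketbra u * ketbra w = z • vecMulVec u (star w) := ketbra_mul_ketbra u w
  have h2 : ketbra w * ketbra u = star z • vecMulVec w (star u) := by
    rw [ketbra_mul_ketbra, hz, star_dotProduct]
  rcases eq_or_ne z 0 with h0 | h0
  · left
    rw [Matrix.mul_sub, h1, h0, zero_smul, Matrix.mul_one, sub_zero]
  · right
    have h3 : z • vecMulVec u (star w) = star z • vecMulVec w (star u) := by
      rw [← h1, ← h2, h.eq]
    have h4 : z • u = (star z * z) • w := by
      have := congrArg (fun X => X *ᵥ w) h3
      simp only [smul_mulVec, vecMulVec_mulVec, ← hz, (isUnitVec_iff w).mp hw] at this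
      simpa [smul_smul] using this
    -- `u` is a multiple of `w`, hence fixed by `ketbra w`
    have h5 : u = (z⁻¹ * (star z * z)) • w := by
      rw [← smul_smul, ← h4, smul_smul, inv_mul_cancel₀ h0, one_smul]
    have h6 : ketbra w * ketbra u = ketbra u := by
      have h7 : ketbra w *ᵥ u = u := by
        rw [h5, mulVec_smul, ketbra, vecMulVec_mulVec, (isUnitVec_iff w).mp hw]
        simp
      rw [ketbra, ketbra, mul_vecMulVec, ← ketbra, h7]
    rw [Matrix.mul_sub, Matrix.mul_one, h.eq, h6, sub_self]

theorem toEuclideanLin_comp_apply {ι : Type*} [Fintype ι] [DecidableEq ι] (X Y : Matrix ι ι ℂ)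
    (y : EuclideanSpace ℂ ι) :
    toEuclideanLin X (toEuclideanLin Y y) = toEuclideanLin (X * Y) y := by
  simp [toLpLin_apply, mulVec_mulVec]

theorem euclidean_inner_eq {ι : Type*} [Fintype ι] (x y : EuclideanSpace ℂ ι) :
    ⟪x, y⟫_ℂ = star x.ofLp ⬝ᵥ y.ofLp := by
  rw [EuclideanSpace.inner_eq_star_dotProduct, dotProduct_comm]

theorem trace_traceSnd_ketbra_mul {α η : Type*} [Fintype α] [Fintype η] [DecidableEq η]
    (ψ : α × η → ℂ) (R : Matrix α α ℂ) :
    (traceSnd (ketbra ψ) * R).trace = star ψ ⬝ᵥ ((R ⊗ₖ (1 : Matrix η η ℂ)) *ᵥ ψ) := by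
  rw [trace_mul_comm]
  simp only [trace, diag_apply, mul_apply, traceSnd, of_apply, ketbra_apply, dotProduct, mulVec,
    kroneckerMap_apply, Fintype.sum_prod_type, one_apply, Finset.mul_sum, Pi.star_apply, mul_ite,
    mul_one, mul_zero, ite_mul, zero_mul, Finset.sum_ite_eq, Finset.mem_univ, if_true]
  refine Finset.sum_congr rfl fun a _ => ?_
  rw [Finset.sum_comm]
  exact Finset.sum_congr rfl fun e _ => Finset.sum_congr rfl fun b _ => by ring

namespace Strategy

variable {N : ℕ} {α η : Type*} [Fintype α] [Fintype η] (S : Strategy N α η)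

/-- The joint state as a vector of the joint Hilbert space. -/
noncomputable def stateVec : EuclideanSpace ℂ (α × η) := WithLp.toLp 2 S.psi

theorem norm_stateVec : ‖S.stateVec‖ = 1 := by
  rw [← sq_eq_sq₀ (norm_nonneg _) zero_le_one, EuclideanSpace.norm_sq_eq, one_pow]
  exact S.psi_unit

variable [DecidableEq α]

/-- The projection onto the event "outcome `1` for measurement `i`, then `0` for `i + 1`". -/
def eventProj (i : ZMod N) : Matrix α α ℂ := S.proj i * (1 - S.proj (i + 1))

theorem isHermitian_eventProj (i : ZMod N) : (S.eventProj i).IsHermitian :=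
  isHermitian_mul_one_sub (ketbra_isHermitian _) (ketbra_isHermitian _) (S.compatible i)

theorem eventProj_mul_self (i : ZMod N) : S.eventProj i * S.eventProj i = S.eventProj i :=
  mul_one_sub_mul_self (S.v_unit i).ketbra_mul_self (S.v_unit (i + 1)).ketbra_mul_self
    (S.compatible i)

theorem eventProj_eq (i : ZMod N) : S.eventProj i = S.proj i ∨ S.eventProj i = 0 :=
  ketbra_mul_one_sub_ketbra (S.v_unit (i + 1)) (S.compatible i)

variable [DecidableEq η]

/-- The event projections as operators on the joint Hilbert space of Alice and Eve. -/
noncomputable def eventOp (i : ZMod N) :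
    EuclideanSpace ℂ (α × η) →ₗ[ℂ] EuclideanSpace ℂ (α × η) :=
  toEuclideanLin (S.eventProj i ⊗ₖ (1 : Matrix η η ℂ))

theorem cyclicProjections_eventOp : CyclicProjections S.eventOp where
  symm i := by
    refine isSymmetric_toEuclideanLin_iff.mpr ?_
    rw [IsHermitian, conjTranspose_kronecker, (S.isHermitian_eventProj i).eq, conjTranspose_one]
  idem i x := by
    rw [eventOp, toEuclideanLin_comp_apply, ← mul_kronecker_mul, S.eventProj_mul_self, one_mul]
  orth_succ i x := by
    have h : S.eventProj i * S.eventProj (i + 1) = 0 := by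
      have h1 : (1 - S.proj (i + 1)) * S.proj (i + 1) = 0 := by
        rw [Matrix.sub_mul, Matrix.one_mul, proj, (S.v_unit (i + 1)).ketbra_mul_self, sub_self]
      rw [eventProj, eventProj, Matrix.mul_assoc, ← Matrix.mul_assoc (1 - _), h1, Matrix.zero_mul,
        Matrix.mul_zero]
    rw [eventOp, eventOp, toEuclideanLin_comp_apply, ← mul_kronecker_mul, h, zero_kronecker,
      map_zero, LinearMap.zero_apply]

theorem beta_eq_sum [NeZero N] : S.beta = ∑ i, ‖S.eventOp i S.stateVec‖ ^ 2 := by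
  refine Finset.sum_congr rfl fun i _ => ?_
  rw [proj, proj, seqProb_one_zero _ (S.v_unit i).ketbra_mul_self (S.v_unit (i + 1)).ketbra_mul_self
    (S.compatible i), aliceState, trace_traceSnd_ketbra_mul]
  have h := S.cyclicProjections_eventOp.inner_self_apply i S.stateVec
  rw [euclidean_inner_eq] at h
  exact congrArg Complex.re h

theorem deficit_le [NeZero N] (hN : 5 ≤ N) (hodd : Odd N) {ε : ℝ} (h : betaQT N - ε ≤ S.beta) :
    deficit S.eventOp S.stateVec ≤ ε := by
  have := lovaszTheta_le_betaQT hN hodd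
  rw [deficit, ← S.beta_eq_sum, S.norm_stateVec]
  linarith

end Strategy

/-! ### One post-selected round -/

theorem omega_zero (N : ℕ) : omega N 0 = Real.cos (Real.pi / N) := by simp [omega]

theorem omega_one (N : ℕ) : omega N 1 = 1 := by simp [omega]

theorem omega_pos {N : ℕ} (hN : 5 ≤ N) (k : Fin 2) : 0 < omega N k := by
  have := half_lt_cos hN
  fin_cases k
  · exact (omega_zero N).symm ▸ (by linarith)
  · exact (omega_one N).symm ▸ one_pos

theorem omega_le_one (N : ℕ) (k : Fin 2) : omega N k ≤ 1 := by
  fin_cases k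
  · exact (omega_zero N).symm ▸ Real.cos_le_one _
  · exact (omega_one N).le

/-- A uniform bit that is independent of Eve's pure state `ξ`. -/
noncomputable def idealRound {η : Type*} (ξ : η → ℂ) : Matrix (Fin 2 × η) (Fin 2 × η) ℂ :=
  (2 : ℂ)⁻¹ • ((1 : Matrix (Fin 2) (Fin 2) ℂ) ⊗ₖ ketbra ξ)

theorem idealRound_posSemidef {η : Type*} [Fintype η] (ξ : η → ℂ) :
    (idealRound ξ).PosSemidef := by
  have h : ((2⁻¹ : ℝ) : ℂ) = (2 : ℂ)⁻¹ := by norm_num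
  rw [idealRound, ← h]
  exact posSemidef_real_smul (PosSemidef.one.kronecker (ketbra_posSemidef ξ)) (by norm_num)

theorem trace_idealRound {η : Type*} [Fintype η] {ξ : η → ℂ} (hξ : IsUnitVec ξ) :
    (idealRound ξ).trace = 1 := by
  rw [idealRound, trace_smul, trace_kronecker, hξ.trace_ketbra]
  simp

theorem traceFst_idealRound {η : Type*} (ξ : η → ℂ) : traceFst (idealRound ξ) = ketbra ξ := by
  rw [idealRound, traceFst_smul, traceFst_kronecker, smul_smul]
  simp

theorem idealRound_eq_add {η : Type*} (ξ : η → ℂ) :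
    idealRound ξ = ((2⁻¹ : ℝ) : ℂ) • (single 0 0 (1 : ℂ) ⊗ₖ ketbra ξ) +
      ((2⁻¹ : ℝ) : ℂ) • (single 1 1 (1 : ℂ) ⊗ₖ ketbra ξ) := by
  have h : (1 : Matrix (Fin 2) (Fin 2) ℂ) = single 0 0 1 + single 1 1 1 := by
    ext i j
    fin_cases i <;> fin_cases j <;> simp
  rw [idealRound, h, add_kronecker, smul_add]
  norm_num

namespace Strategy

variable {N : ℕ} {α η : Type*} [Fintype α] [Fintype η] (S : Strategy N α η)

/-- Eve's unnormalized state after outcome `1` of Alice's measurement `1`. -/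
noncomputable def eveVec (e : η) : ℂ := ∑ b, star (S.v 1 b) * S.psi (b, e)

/-- The probability of outcome `1` of Alice's measurement `1`. -/
noncomputable def probOne : ℝ := ∑ e, ‖S.eveVec e‖ ^ 2

theorem probOne_nonneg : 0 ≤ S.probOne := Finset.sum_nonneg fun _ _ => by positivity

theorem cos_le_normalization (hN : 5 ≤ N) : Real.cos (Real.pi / N) ≤
    Real.cos (Real.pi / N) * (1 - S.probOne) + S.probOne := by
  nlinarith [S.probOne_nonneg, half_lt_cos hN, cos_lt_one hN]

variable [DecidableEq α]

theorem effect_proj_one_zero : effect (S.proj 1) 0 = 1 - S.proj 1 := by simp [effect]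

theorem effect_proj_one_one : effect (S.proj 1) 1 = S.proj 1 := by simp [effect]

theorem sum_effect : ∑ k, effect (S.proj 1) k = 1 := by
  rw [Fin.sum_univ_two, effect_proj_one_zero, effect_proj_one_one, sub_add_cancel]

theorem effect_posSemidef (k : Fin 2) : (effect (S.proj 1) k).PosSemidef := by
  fin_cases k
  · have hP : S.proj 1 * S.proj 1 = S.proj 1 := (S.v_unit 1).ketbra_mul_self
    have h : (1 - S.proj 1)ᴴ * (1 - S.proj 1) = 1 - S.proj 1 := by
      rw [conjTranspose_sub, conjTranspose_one, proj, (ketbra_isHermitian _).eq, ← proj,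
        Matrix.mul_sub, Matrix.sub_mul, Matrix.sub_mul, hP]
      simp
    have := posSemidef_conjTranspose_mul_self (1 - S.proj 1)
    rw [h] at this
    exact S.effect_proj_one_zero ▸ this
  · exact S.effect_proj_one_one ▸ ketbra_posSemidef _

variable [DecidableEq η]

theorem trace_kept :
    (keptState (ketbra S.psi) (effect (S.proj 1)) (omega N)).trace =
      ((Real.cos (Real.pi / N) * (1 - S.probOne) + S.probOne : ℝ) : ℂ) := by
  have h1 : (traceFst ((S.proj 1 ⊗ₖ (1 : Matrix η η ℂ)) * ketbra S.psi)).trace =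
      (S.probOne : ℂ) := by
    rw [proj, traceFst_ketbra_kronecker_mul_ketbra, trace_ketbra]
    rfl
  have h0 : (traceFst (((1 - S.proj 1) ⊗ₖ (1 : Matrix η η ℂ)) * ketbra S.psi)).trace =
      1 - (S.probOne : ℂ) := by
    have h2 : (1 - S.proj 1) ⊗ₖ (1 : Matrix η η ℂ) = 1 - S.proj 1 ⊗ₖ (1 : Matrix η η ℂ) := by
      rw [eq_sub_iff_add_eq, ← add_kronecker, sub_add_cancel, one_kronecker_one]
    rw [trace_traceFst] at h1 ⊢
    rw [h2, Matrix.sub_mul, trace_sub, Matrix.one_mul, S.psi_unit.trace_ketbra, h1]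
  rw [trace_keptState, Fin.sum_univ_two, effect_proj_one_zero, effect_proj_one_one, h0, h1,
    omega_zero, omega_one]
  push_cast
  ring

theorem trace_roundState (hN : 5 ≤ N) : (roundState S).trace = 1 := by
  rw [roundState, postSelected, trace_smul, smul_eq_mul]
  refine inv_mul_cancel₀ ?_
  rw [trace_kept]
  have h1 := S.cos_le_normalization hN
  have h2 := half_lt_cos hN
  exact_mod_cast (by linarith : 0 <
    Real.cos (Real.pi / N) * (1 - S.probOne) + S.probOne).ne'

theorem roundState_posSemidef (hN : 5 ≤ N) : (roundState S).PosSemidef := by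
  rw [roundState, postSelected, trace_kept, ← Complex.ofReal_inv]
  refine posSemidef_real_smul (keptState_posSemidef (ketbra_posSemidef _) S.effect_posSemidef
    fun k => (omega_pos hN k).le) (inv_nonneg.mpr ?_)
  have h1 := S.cos_le_normalization hN
  have h2 := half_lt_cos hN
  linarith

/-- If the joint state is close to a product vector `a ⊗ ξ` and outcome `1` has nearly the optimal
probability `c / (1 + c)`, then post-selection produces nearly a uniform bit and the state `ξ`. The
post-selection map does not increase trace distances, and on `a ⊗ ξ` it can be evaluated. -/
theorem hasTraceNormLE_roundState_sub (hN : 5 ≤ N) {a : α → ℂ} {ξ : η → ℂ} (hξ : IsUnitVec ξ)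
    {δ κ : ℝ} (hδ : 0 ≤ δ) (hs : ∑ x, ‖S.psi x + a x.1 * ξ x.2‖ ^ 2 ≤ 4)
    (hd : ∑ x, ‖S.psi x - a x.1 * ξ x.2‖ ^ 2 ≤ δ ^ 2)
    (ha : star a ⬝ᵥ (S.proj 1 *ᵥ a) = (S.probOne : ℂ))
    (hκ : |(1 + Real.cos (Real.pi / N)) * S.probOne - Real.cos (Real.pi / N)| ≤ κ) :
    HasTraceNormLE (roundState S - idealRound ξ) (10 * δ + 2 * κ) := by
  have hc := half_lt_cos hN
  have hc1 := cos_lt_one hN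
  have hZ := S.cos_le_normalization hN
  have htr := S.trace_kept
  set c := Real.cos (Real.pi / N) with hcdef
  set t := S.probOne with ht
  set Z := c * (1 - t) + t with hZdef
  have hZ0 : 0 < Z := by linarith
  set φ : α × η → ℂ := fun x => a x.1 * ξ x.2 with hφ
  set s : ℝ := ∑ i, ‖a i‖ ^ 2 with hsdef
  have hdiff := hasTraceNormLE_ketbra_sub S.psi φ hδ hs hd
  have hφs : ∑ x, ‖φ x‖ ^ 2 = s := by
    simp only [hφ, norm_mul, mul_pow, Fintype.sum_prod_type]
    have h1 : ∑ e, ‖ξ e‖ ^ 2 = 1 := hξ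
    simp_rw [← Finset.mul_sum, h1, mul_one, hsdef]
  have hs1 : |1 - s| ≤ 5 / 2 * δ := by
    have := hdiff.abs_re_trace_le
    rwa [trace_sub, S.psi_unit.trace_ketbra, trace_ketbra, hφs, Complex.sub_re, Complex.one_re,
      Complex.ofReal_re] at this
  have has : star a ⬝ᵥ a = (s : ℂ) := by
    rw [hsdef, ← trace_ketbra, ketbra, trace_vecMulVec, dotProduct_comm]
  have hkφ : keptState (ketbra φ) (effect (S.proj 1)) (omega N) =
      ((c * (s - t) : ℝ) : ℂ) • (single 0 0 (1 : ℂ) ⊗ₖ ketbra ξ) +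
        ((t : ℝ) : ℂ) • (single 1 1 (1 : ℂ) ⊗ₖ ketbra ξ) := by
    rw [hφ, keptState_ketbra_prod, Fin.sum_univ_two, effect_proj_one_zero, effect_proj_one_one,
      sub_mulVec, one_mulVec, dotProduct_sub, ha, has, omega_zero, omega_one, ← hcdef]
    push_cast
    rw [one_mul]
  have hk : HasTraceNormLE (keptState (ketbra S.psi) (effect (S.proj 1)) (omega N) -
      keptState (ketbra φ) (effect (S.proj 1)) (omega N)) (5 / 2 * δ) := by
    have := hdiff.map (keptLin η (effect (S.proj 1)) (omega N)) zero_le_one fun P hP =>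
      ⟨keptState_posSemidef hP S.effect_posSemidef fun k => (omega_pos hN k).le, by
        rw [one_mul]
        exact re_trace_keptState_le hP S.effect_posSemidef S.sum_effect (omega_le_one N)⟩
    rw [one_mul, map_sub] at this
    exact this
  have hsplit : roundState S - idealRound ξ =
      ((Z⁻¹ : ℝ) : ℂ) • (keptState (ketbra S.psi) (effect (S.proj 1)) (omega N) -
        keptState (ketbra φ) (effect (S.proj 1)) (omega N)) +
      (((Z⁻¹ * (c * (s - t)) - 2⁻¹ : ℝ) : ℂ) • (single 0 0 (1 : ℂ) ⊗ₖ ketbra ξ) +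
        ((Z⁻¹ * t - 2⁻¹ : ℝ) : ℂ) • (single 1 1 (1 : ℂ) ⊗ₖ ketbra ξ)) := by
    rw [roundState, postSelected, htr, hkφ, idealRound_eq_add, ← Complex.ofReal_inv]
    push_cast
    module
  have hpsd : ∀ k : Fin 2, (single k k (1 : ℂ) ⊗ₖ ketbra ξ).PosSemidef := fun k =>
    (single_posSemidef k).kronecker (ketbra_posSemidef ξ)
  have htr1 : ∀ k : Fin 2, (single k k (1 : ℂ) ⊗ₖ ketbra ξ).trace.re = 1 := fun k => by
    rw [trace_kronecker, hξ.trace_ketbra, trace_single_eq_same]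
    simp
  have hZi : Z⁻¹ ≤ 2 := by
    rw [inv_le_comm₀ hZ0 two_pos]
    linarith
  have hZi0 : 0 < Z⁻¹ := inv_pos.mpr hZ0
  have hκ0 : 0 ≤ κ := (abs_nonneg _).trans hκ
  have e1 : |Z⁻¹ * t - 2⁻¹| ≤ κ := by
    have : Z⁻¹ * t - 2⁻¹ = 2⁻¹ * Z⁻¹ * ((1 + c) * t - c) := by
      rw [hZdef] at hZ0 ⊢
      field_simp
      ring
    rw [this, abs_mul, abs_of_pos (by positivity)]
    nlinarith [abs_nonneg ((1 + c) * t - c)]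
  have e0 : |Z⁻¹ * (c * (s - t)) - 2⁻¹| ≤ κ + 5 * δ := by
    have : Z⁻¹ * (c * (s - t)) - 2⁻¹ =
        2⁻¹ * Z⁻¹ * (-((1 + c) * t - c)) - Z⁻¹ * (c * (1 - s)) := by
      rw [hZdef] at hZ0 ⊢
      field_simp
      ring
    rw [this]
    refine (abs_sub _ _).trans (add_le_add ?_ ?_)
    · rw [abs_mul, abs_neg, abs_of_pos (by positivity)]
      nlinarith [abs_nonneg ((1 + c) * t - c)]
    · rw [abs_mul, abs_mul, abs_of_pos hZi0, abs_of_pos (by linarith : 0 < c)]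
      have := abs_nonneg (1 - s)
      nlinarith [mul_le_mul_of_nonneg_left hs1 (by positivity : 0 ≤ Z⁻¹),
        mul_nonneg hZi0.le this]
  rw [hsplit]
  have hA := hk.real_smul hZi0.le
  have hB := (hasTraceNormLE_real_smul (hpsd 0) (Z⁻¹ * (c * (s - t)) - 2⁻¹)).add
    (hasTraceNormLE_real_smul (hpsd 1) (Z⁻¹ * t - 2⁻¹))
  refine (hA.add hB).mono ?_
  rw [htr1, htr1]
  nlinarith [mul_le_mul_of_nonneg_right hZi (by positivity : 0 ≤ 5 / 2 * δ)]

end Strategy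

/-- The constant in the single-round bound: the first term comes from the distance to a product
vector, the second one from the deviation of the outcome probability from its optimal value. -/
noncomputable def roundConst (N : ℕ) : ℝ :=
  10 * √(gapConst N) + 2 * ((1 + 4 * N / (2 * Real.cos (Real.pi / N) - 1)) * √32)

theorem le_roundConst {N : ℕ} (hN : 5 ≤ N) : 10 * √(gapConst N) ≤ roundConst N := by
  have hc := half_lt_cos hN
  have : 0 ≤ 4 * (N : ℝ) / (2 * Real.cos (Real.pi / N) - 1) :=
    div_nonneg (by positivity) (by linarith)
  rw [roundConst]
  have h2 : 0 ≤ (1 + 4 * N / (2 * Real.cos (Real.pi / N) - 1)) * √32 := by positivity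
  linarith

theorem exists_isUnitVec (η : Type*) [Fintype η] [DecidableEq η] [Nonempty η] :
    ∃ ξ : η → ℂ, IsUnitVec ξ := by
  obtain ⟨e⟩ := ‹Nonempty η›
  exact ⟨Pi.single e 1, by simp [isUnitVec_iff]⟩

namespace Strategy

variable {N : ℕ} {α η : Type*} [Fintype α] [Fintype η] (S : Strategy N α η)

theorem sum_star_mul_contract (ξ : η → ℂ) :
    ∑ b, star (S.v 1 b) * ∑ e, star (ξ e) * S.psi (b, e) = ∑ e, star (ξ e) * S.eveVec e := by
  simp only [eveVec, Finset.mul_sum]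
  rw [Finset.sum_comm]
  exact Finset.sum_congr rfl fun e _ => Finset.sum_congr rfl fun b _ => by ring

theorem nonempty_eve (S : Strategy N α η) : Nonempty η := by
  by_contra h
  rw [not_nonempty_iff] at h
  have := S.psi_unit
  rw [IsUnitVec, Finset.univ_eq_empty, Finset.sum_empty] at this
  exact zero_ne_one this

variable [DecidableEq α] [DecidableEq η]

theorem eventOp_one_apply (h : S.eventProj 1 = S.proj 1) (x : α × η) :
    S.eventOp 1 S.stateVec x = S.v 1 x.1 * S.eveVec x.2 := by
  obtain ⟨a, e⟩ := x
  rw [eventOp, h, toLpLin_apply]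
  simp only [stateVec, mulVec, dotProduct, kroneckerMap_apply, Fintype.sum_prod_type, one_apply,
    mul_ite, mul_one, mul_zero, ite_mul, zero_mul, Finset.sum_ite_eq, Finset.mem_univ, if_true,
    proj, ketbra_apply, eveVec, Finset.mul_sum, mul_assoc]

theorem norm_eventOp_one_sq (h : S.eventProj 1 = S.proj 1) :
    ‖S.eventOp 1 S.stateVec‖ ^ 2 = S.probOne := by
  rw [EuclideanSpace.norm_sq_eq, probOne]
  simp only [S.eventOp_one_apply h, norm_mul, mul_pow, Fintype.sum_prod_type]
  simp_rw [← Finset.mul_sum]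
  have h1 : ∑ a, ‖S.v 1 a‖ ^ 2 = 1 := S.v_unit 1
  rw [← Finset.sum_mul, h1, one_mul]

variable [NeZero N]

/-- The single-round bound. Eve's pure state `ξ` is her normalized state after outcome `1`. The
projection onto the span of `ξ` on Eve's side commutes with all of Alice's projections and fixes the
state after outcome `1`, so by the spectral gap it almost fixes the joint state, which is therefore
close to a product vector. If the event of outcome `1` is a null event, then the spectral gap makes
`ε` so large that the bound is void. -/
theorem exists_hasTraceNormLE (hN : 5 ≤ N) (hodd : Odd N) {ε : ℝ} (hε : 0 ≤ ε)
    (hβ : betaQT N - ε ≤ S.beta) : ∃ ξ : η → ℂ, IsUnitVec ξ ∧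
      HasTraceNormLE (roundState S - idealRound ξ) (roundConst N * √ε) := by
  have hQ := S.cyclicProjections_eventOp
  have hD := S.deficit_le hN hodd hβ
  have hg := gapConst_nonneg N
  have hC := le_roundConst hN
  by_cases h0 : S.eventOp 1 S.stateVec = 0
  · have := S.nonempty_eve
    obtain ⟨ξ, hξ⟩ := exists_isUnitVec η
    refine ⟨ξ, hξ, (HasTraceNormLE.sub_of_posSemidef (S.roundState_posSemidef hN)
      (idealRound_posSemidef ξ)).mono ?_⟩
    rw [S.trace_roundState hN, trace_idealRound hξ, Complex.one_re]
    have h1 := hQ.norm_sq_le_of_apply_eq_zero hN hodd h0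
    rw [S.norm_stateVec] at h1
    have h2 : 1 ≤ √(gapConst N) * √ε := by
      rw [← Real.sqrt_mul hg]
      exact Real.one_le_sqrt.mpr (by nlinarith)
    nlinarith [mul_le_mul_of_nonneg_right hC (Real.sqrt_nonneg ε)]
  · have hP : S.eventProj 1 = S.proj 1 := (S.eventProj_eq 1).resolve_right fun h => h0 (by
      rw [eventOp, h, zero_kronecker, map_zero, LinearMap.zero_apply])
    have ht := S.norm_eventOp_one_sq hP
    have ht0 : 0 < S.probOne := by
      rw [← ht]
      have := norm_pos_iff.mpr h0
      positivity
    set r := √S.probOne with hr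
    have hr0 : 0 < r := Real.sqrt_pos.mpr ht0
    have hrr : r ^ 2 = S.probOne := Real.sq_sqrt ht0.le
    have hrc : (r : ℂ) ≠ 0 := by exact_mod_cast hr0.ne'
    set ξ : η → ℂ := fun e => (r : ℂ)⁻¹ * S.eveVec e with hξdef
    have hfξ : ∀ e, S.eveVec e = r * ξ e := fun e => by
      rw [hξdef]
      field_simp
    have hξ : IsUnitVec ξ := by
      simp only [IsUnitVec, hξdef, norm_mul, norm_inv, Complex.norm_real, Real.norm_eq_abs,
        abs_of_pos hr0, mul_pow, inv_pow, hrr, ← Finset.mul_sum]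
      exact inv_mul_cancel₀ ht0.ne'
    set F : EuclideanSpace ℂ (α × η) →ₗ[ℂ] EuclideanSpace ℂ (α × η) :=
      toEuclideanLin ((1 : Matrix α α ℂ) ⊗ₖ ketbra ξ) with hF
    set a : α → ℂ := fun b => ∑ e, star (ξ e) * S.psi (b, e) with ha
    have hFapply : ∀ (y : EuclideanSpace ℂ (α × η)) (b : α) (e : η),
        F y (b, e) = (∑ e', star (ξ e') * y (b, e')) * ξ e := fun y b e => by
      rw [hF, toLpLin_apply]
      simp only [mulVec, dotProduct, kroneckerMap_apply, Fintype.sum_prod_type, one_apply,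
        ite_mul, one_mul, zero_mul, ketbra_apply, Finset.sum_mul]
      rw [Finset.sum_eq_single b (fun b' _ hb => by simp [hb.symm]) (by simp)]
      exact Finset.sum_congr rfl fun e' _ => by rw [if_pos rfl]; ring
    have hFsymm : ∀ x z, ⟪F x, z⟫_ℂ = ⟪x, F z⟫_ℂ := by
      refine isSymmetric_toEuclideanLin_iff.mpr ?_
      rw [IsHermitian, conjTranspose_kronecker, (ketbra_isHermitian ξ).eq, conjTranspose_one]
    have hFidem : ∀ x, F (F x) = F x := fun x => by
      rw [hF, toEuclideanLin_comp_apply, ← mul_kronecker_mul, hξ.ketbra_mul_self, one_mul]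
    have hFQ : ∀ i x, F (S.eventOp i x) = S.eventOp i (F x) := fun i x => by
      rw [hF, eventOp, toEuclideanLin_comp_apply, toEuclideanLin_comp_apply, ← mul_kronecker_mul,
        ← mul_kronecker_mul, Matrix.one_mul, Matrix.mul_one, Matrix.one_mul, Matrix.mul_one]
    have hξξ : ∑ e, star (ξ e) * ξ e = 1 := (isUnitVec_iff ξ).mp hξ
    have hfix : F (S.eventOp 1 S.stateVec) = S.eventOp 1 S.stateVec := by
      ext ⟨b, e⟩
      rw [hFapply]
      simp only [S.eventOp_one_apply hP, hfξ]
      have : ∑ e', star (ξ e') * (S.v 1 b * (r * ξ e')) =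
          S.v 1 b * r * ∑ e', star (ξ e') * ξ e' := by
        rw [Finset.mul_sum]
        exact Finset.sum_congr rfl fun e' _ => by ring
      rw [this, hξξ]
      ring
    have hclose := hQ.norm_sub_sq_le_of_commute hN hodd F hFsymm hFidem hFQ hfix
    have hFψ : ∀ x : α × η, F S.stateVec x = a x.1 * ξ x.2 := fun x => hFapply _ x.1 x.2
    set δ := √(gapConst N) * √ε with hδ
    have hδ0 : 0 ≤ δ := by positivity
    have hδ2 : δ ^ 2 = gapConst N * ε := by
      rw [hδ, mul_pow, Real.sq_sqrt hg, Real.sq_sqrt hε]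
    have hd : ∑ x, ‖S.psi x - a x.1 * ξ x.2‖ ^ 2 ≤ δ ^ 2 := by
      rw [EuclideanSpace.norm_sq_eq] at hclose
      simp only [PiLp.sub_apply, hFψ] at hclose
      rw [hδ2]
      exact hclose.trans (mul_le_mul_of_nonneg_left hD hg)
    have hFle : ‖F S.stateVec‖ ≤ 1 := by
      have h1 : ⟪F S.stateVec, S.stateVec - F S.stateVec⟫_ℂ = 0 := by
        rw [hFsymm, map_sub, hFidem, sub_self, inner_zero_right]
      have h2 := norm_add_sq_eq_norm_sq_add_norm_sq_of_inner_eq_zero _ _ h1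
      rw [add_sub_cancel, S.norm_stateVec] at h2
      nlinarith [norm_nonneg (F S.stateVec), norm_nonneg (S.stateVec - F S.stateVec)]
    have hs : ∑ x, ‖S.psi x + a x.1 * ξ x.2‖ ^ 2 ≤ 4 := by
      have h1 : ‖S.stateVec + F S.stateVec‖ ≤ 2 :=
        (norm_add_le _ _).trans (by rw [S.norm_stateVec]; linarith)
      have h2 : ‖S.stateVec + F S.stateVec‖ ^ 2 ≤ 4 := by
        nlinarith [norm_nonneg (S.stateVec + F S.stateVec)]
      rw [EuclideanSpace.norm_sq_eq] at h2
      simp only [PiLp.add_apply, hFψ] at h2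
      exact h2
    have hva : star (S.v 1) ⬝ᵥ a = (r : ℂ) := by
      have h1 := S.sum_star_mul_contract ξ
      simp only [hfξ] at h1
      have h2 : ∑ e, star (ξ e) * (r * ξ e) = r * ∑ e, star (ξ e) * ξ e := by
        rw [Finset.mul_sum]
        exact Finset.sum_congr rfl fun e _ => by ring
      rw [h2, hξξ, mul_one] at h1
      exact h1
    have haPa : star a ⬝ᵥ (S.proj 1 *ᵥ a) = (S.probOne : ℂ) := by
      have h1 : star a ⬝ᵥ S.v 1 = (r : ℂ) := by
        rw [star_dotProduct, hva]
        exact Complex.conj_ofReal r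
      rw [proj, ketbra, vecMulVec_mulVec, hva, ← hrr, dotProduct_smul, h1]
      simp [sq]
    have hκ := hQ.abs_prob_sub_le hN hodd S.norm_stateVec 1
    rw [ht] at hκ
    have hcN : 0 ≤ 1 + 4 * (N : ℝ) / (2 * Real.cos (Real.pi / N) - 1) := by
      have := half_lt_cos hN
      have h1 : 0 ≤ 4 * (N : ℝ) / (2 * Real.cos (Real.pi / N) - 1) :=
        div_nonneg (by positivity) (by linarith)
      linarith
    have hκ' := hκ.trans (mul_le_mul_of_nonneg_left
      (Real.sqrt_le_sqrt (mul_le_mul_of_nonneg_left hD (by norm_num : (0 : ℝ) ≤ 32))) hcN)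
    refine ⟨ξ, hξ, (S.hasTraceNormLE_roundState_sub hN hξ hδ0 hs hd haPa hκ').mono ?_⟩
    rw [roundConst, hδ, Real.sqrt_mul (by norm_num : (0 : ℝ) ≤ 32)]
    exact le_of_eq (by ring)

end Strategy

/-! ### Many rounds -/

section Protocol

/-- Regroups a pair of families into a family of pairs. -/
def pairEquiv {ι : Type*} (K E : ι → Type*) : ((∀ j, K j) × ∀ j, E j) ≃ ∀ j, K j × E j where
  toFun x j := (x.1 j, x.2 j)
  invFun y := (fun j => (y j).1, fun j => (y j).2)
  left_inv _ := rfl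
  right_inv _ := rfl

theorem HasTraceNormLE.submatrix {n m : Type*} [Fintype n] [Fintype m] {X : Matrix n n ℂ} {r : ℝ}
    (h : HasTraceNormLE X r) (e : m ≃ n) : HasTraceNormLE (X.submatrix e e) r := by
  obtain ⟨P, Q, hP, hQ, rfl, hr⟩ := h
  have htr : ∀ Y : Matrix n n ℂ, (Y.submatrix e e).trace = Y.trace := fun Y => by
    simp only [trace, diag_apply, submatrix_apply]
    exact e.sum_comp fun i => Y i i
  exact ⟨_, _, hP.submatrix e, hQ.submatrix e, rfl, by rwa [htr, htr]⟩

variable {m : ℕ} {E : Fin m → Type*}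

theorem idealState_tensorPi_ketbra (ξ : ∀ j, E j → ℂ) :
    idealState (tensorPi fun j => ketbra (ξ j)) =
      (tensorPi fun j => idealRound (ξ j)).submatrix
        (pairEquiv (fun _ => Fin 2) E) (pairEquiv (fun _ => Fin 2) E) := by
  ext ⟨k, e⟩ ⟨k', e'⟩
  simp only [idealState, idealRound, Matrix.smul_apply, kroneckerMap_apply, submatrix_apply,
    tensorPi_apply, pairEquiv, Equiv.coe_fn_mk, smul_eq_mul, Finset.prod_mul_distrib,
    Finset.prod_const, Finset.card_univ, Fintype.card_fin, inv_pow, one_apply]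
  congr 2
  by_cases hk : k = k'
  · subst hk
    simp
  · rw [if_neg hk]
    obtain ⟨j, hj⟩ := Function.ne_iff.mp hk
    exact (Finset.prod_eq_zero (Finset.mem_univ j) (if_neg hj)).symm

theorem idealState_sub (X Y : Matrix (∀ j, E j) (∀ j, E j) ℂ) :
    idealState (X - Y) = idealState X - idealState Y := by
  have h : (1 : Matrix (Fin m → Fin 2) (Fin m → Fin 2) ℂ) ⊗ₖ (X - Y) = 1 ⊗ₖ X - 1 ⊗ₖ Y := by
    rw [eq_sub_iff_add_eq, ← kronecker_add, sub_add_cancel]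
  rw [idealState, h, smul_sub, ← idealState, ← idealState]

theorem traceFst_idealState (σ : Matrix (∀ j, E j) (∀ j, E j) ℂ) :
    traceFst (idealState σ) = σ := by
  rw [idealState, traceFst_smul, traceFst_kronecker, smul_smul, trace_one]
  simp

variable [∀ j, Fintype (E j)]

theorem HasTraceNormLE.idealState {X : Matrix (∀ j, E j) (∀ j, E j) ℂ} {r : ℝ}
    (h : HasTraceNormLE X r) : HasTraceNormLE (idealState X) r := by
  obtain ⟨P, Q, hP, hQ, rfl, hr⟩ := h
  have h2 : ((2 : ℂ) ^ m)⁻¹ = ((((2 : ℝ) ^ m)⁻¹ : ℝ) : ℂ) := by push_cast; rfl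
  have hpsd : ∀ Y : Matrix (∀ j, E j) (∀ j, E j) ℂ, Y.PosSemidef →
      (NCRandomness.idealState Y).PosSemidef := fun Y hY => by
    rw [NCRandomness.idealState, h2]
    exact posSemidef_real_smul (PosSemidef.one.kronecker hY) (by positivity)
  have htr : ∀ Y : Matrix (∀ j, E j) (∀ j, E j) ℂ, (NCRandomness.idealState Y).trace = Y.trace :=
    fun Y => by rw [← trace_traceFst, traceFst_idealState]
  exact ⟨_, _, hpsd P hP, hpsd Q hQ, idealState_sub P Q, by rwa [htr, htr]⟩

variable {N : ℕ} {A : Fin m → Type*} [∀ j, Fintype (A j)] [∀ j, DecidableEq (A j)]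
  [∀ j, DecidableEq (E j)] (S : ∀ j, Strategy N (A j) (E j))

theorem keptState_jointPsi :
    keptState (ketbra (jointPsi S))
      (fun k : Fin m → Fin 2 => tensorPi fun j => effect ((S j).proj 1) (k j))
      (fun k => ∏ j, omega N (k j)) =
    (tensorPi fun j => keptState (ketbra (S j).psi) (effect ((S j).proj 1)) (omega N)).submatrix
      (pairEquiv (fun _ => Fin 2) E) (pairEquiv (fun _ => Fin 2) E) := by
  ext ⟨k, e⟩ ⟨k', e'⟩
  rw [keptState_apply, submatrix_apply, tensorPi_apply]
  simp only [pairEquiv, Equiv.coe_fn_mk, keptState_apply]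
  by_cases hk : k = k'
  · subst hk
    simp only [if_true]
    rw [Finset.prod_mul_distrib, Complex.ofReal_prod, Finset.prod_univ_sum, Fintype.piFinset_univ]
    congr 1
    refine Finset.sum_congr rfl fun a _ => ?_
    rw [Finset.prod_univ_sum, Fintype.piFinset_univ]
    refine Finset.sum_congr rfl fun b _ => ?_
    simp only [tensorPi_apply, ketbra_apply, jointPsi, star_prod, ← Finset.prod_mul_distrib]
  · rw [if_neg hk]
    obtain ⟨j, hj⟩ := Function.ne_iff.mp hk
    exact (Finset.prod_eq_zero (Finset.mem_univ j) (if_neg hj)).symm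

/-- The final state is the tensor product of the states of the rounds. -/
theorem finalState_eq :
    finalState S = (tensorPi fun j => roundState (S j)).submatrix
      (pairEquiv (fun _ => Fin 2) E) (pairEquiv (fun _ => Fin 2) E) := by
  set X := fun j => keptState (ketbra (S j).psi) (effect ((S j).proj 1)) (omega N) with hX
  have htr : ((tensorPi X).submatrix (pairEquiv (fun _ => Fin 2) E)
      (pairEquiv (fun _ => Fin 2) E)).trace = ∏ j, (X j).trace := by
    rw [← trace_tensorPi]
    simp only [trace, diag_apply, submatrix_apply]
    exact (pairEquiv (fun _ => Fin 2) E).sum_comp fun i => tensorPi X i i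
  rw [finalState, postSelected, keptState_jointPsi, ← hX, htr]
  ext x y
  simp only [Matrix.smul_apply, submatrix_apply, tensorPi_apply, roundState, postSelected,
    smul_eq_mul, Finset.prod_mul_distrib, Finset.prod_inv_distrib]
  rfl

end Protocol

end NCRandomness

theorem theorem3 (N : ℕ) [NeZero N] (hN : 5 ≤ N) (hodd : Odd N) :
    ∃ C : ℝ, ∀ (m : ℕ) (A E : Fin m → Type)
      [∀ j, Fintype (A j)] [∀ j, DecidableEq (A j)]
      [∀ j, Fintype (E j)] [∀ j, DecidableEq (E j)]
      (S : ∀ j, NCRandomness.Strategy N (A j) (E j)) (ε : ℝ), 0 ≤ ε →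
      (∀ j, NCRandomness.betaQT N - ε ≤ (S j).beta) →
      ∃ ξ : ∀ j, E j → ℂ,
        (∀ j, NCRandomness.IsUnitVec (ξ j)) ∧
        (∀ j, NCRandomness.traceNorm
          (NCRandomness.traceFst (NCRandomness.roundState (S j)) - NCRandomness.ketbra (ξ j))
            ≤ C * √ε) ∧
        NCRandomness.traceNorm (NCRandomness.finalState S -
          NCRandomness.idealState (NCRandomness.tensorPi fun j => NCRandomness.ketbra (ξ j)))
            ≤ C * (m * √ε) ∧
        NCRandomness.traceNorm (NCRandomness.finalState S -
          NCRandomness.idealState (NCRandomness.traceFst (NCRandomness.finalState S)))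
            ≤ C * (m * √ε) := by
  have hC : 0 ≤ NCRandomness.roundConst N :=
    (by positivity : (0 : ℝ) ≤ 10 * √(NCRandomness.gapConst N)).trans
      (NCRandomness.le_roundConst hN)
  -- replacing `ρ_E` by Eve's exact reduced state costs a second copy of the bound
  refine ⟨2 * NCRandomness.roundConst N, ?_⟩
  intro m A E _ _ _ _ S ε hε hβ
  choose ξ hξ hbound using fun j => (S j).exists_hasTraceNormLE hN hodd hε (hβ j)
  have hfinal : NCRandomness.HasTraceNormLE (NCRandomness.finalState S -
      NCRandomness.idealState (NCRandomness.tensorPi fun j => NCRandomness.ketbra (ξ j)))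
      (NCRandomness.roundConst N * (m * √ε)) := by
    rw [NCRandomness.finalState_eq, NCRandomness.idealState_tensorPi_ketbra]
    have := (NCRandomness.hasTraceNormLE_tensorPi_sub (fun j => (S j).roundState_posSemidef hN)
      (fun j => NCRandomness.idealRound_posSemidef (ξ j)) (fun j => (S j).trace_roundState hN)
      (fun j => NCRandomness.trace_idealRound (hξ j)) hbound).submatrix
        (NCRandomness.pairEquiv (fun _ => Fin 2) E)
    refine this.mono (le_of_eq ?_)
    rw [Finset.sum_const, Finset.card_univ, Fintype.card_fin, nsmul_eq_mul]
    ring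
  have hpos : 0 ≤ NCRandomness.roundConst N * (m * √ε) := by positivity
  refine ⟨ξ, hξ, fun j => ?_, ?_, ?_⟩
  · have h := (hbound j).traceFst
    have hsub : NCRandomness.traceFst
        (NCRandomness.roundState (S j) - NCRandomness.idealRound (ξ j)) =
        NCRandomness.traceFst (NCRandomness.roundState (S j)) - NCRandomness.ketbra (ξ j) := by
      rw [← NCRandomness.traceFst_idealRound (ξ j)]
      exact map_sub (NCRandomness.traceFstLin (Fin 2) (E j)) _ _
    rw [hsub] at h
    have : 0 ≤ NCRandomness.roundConst N * √ε := by positivity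
    exact h.traceNorm_le.trans (by linarith)
  · exact hfinal.traceNorm_le.trans (by linarith)
  · set σ := NCRandomness.tensorPi fun j => NCRandomness.ketbra (ξ j)
    have h1 := hfinal.traceFst.idealState.neg
    have hsub : -NCRandomness.idealState (NCRandomness.traceFst
        (NCRandomness.finalState S - NCRandomness.idealState σ)) =
        NCRandomness.idealState σ -
          NCRandomness.idealState (NCRandomness.traceFst (NCRandomness.finalState S)) := by
      have h2 : NCRandomness.traceFst (NCRandomness.finalState S - NCRandomness.idealState σ) =
          NCRandomness.traceFst (NCRandomness.finalState S) - σ := by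
        conv_rhs => rw [← NCRandomness.traceFst_idealState σ]
        exact map_sub (NCRandomness.traceFstLin (Fin m → Fin 2) (∀ j, E j)) _ _
      rw [h2, NCRandomness.idealState_sub, neg_sub]
    rw [hsub] at h1
    have h3 := hfinal.add h1
    rw [sub_add_sub_cancel] at h3
    exact h3.traceNorm_le.trans (by linarith)
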